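/- Let $X=(X_t)_{t\ge 0}$ be a real-valued Lévy process with $X_0=0$ on a probability space $(\Omega,\mathcal F,\mathbb P)$, with $\mathbb E[e^{i\lambda X_t}]=e^{-t\Psi(\lambda)}$, $$\Psi(\lambda)=-i\gamma\lambda+\tfrac12\sigma^2\lambda^2+\int_{\mathbb R\setminus\{0\}}\bigl(1-e^{i\lambda z}+i\lambda z1_{\{|z|<1\}}\bigr)\,\Pi(dz),$$ where $\gamma\in\mathbb R$, $\sigma\ge 0$ and $\int_{\mathbb R\setminus\{0\}}(1\wedge z^2)\,\Pi(dz)<\infty$. For $x\in\mathbb R$ write $\mathbb E_x$ for the expectation when the process is started from $x$ (that is, when $X$ is replaced by $x+X$). Assume that $X$ is not a driftless compound Poisson process (the zero process counts as one), and that $\int_{\mathbb R\setminus(-1,1)}e^{\bar\theta|z|}\,\Pi(dz)<\infty$ for some $\bar\theta>0$. Let $0=T(0)<T(1)<T(2)<\cdots$, where $T(1),T(2),\dots$ are the arrival times of a Poisson process of intensity $\eta>0$ independent of $X$, and let $\mathcal T_\eta=\{T(k):k\ge1\}$. For $b\in\mathbb R$ set $T_b^{(0)}=0$ and, for $n\ge1$,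 $$T_b^{(n)}=\inf\{t\in\mathcal T_\eta:\ t>T_b^{(n-1)},\ \tilde X^{(n-1),b}_t<b\},\qquad \tilde X^{(0),b}_t=X_t,\quad \tilde X^{(m),b}_t=b+X_t-X_{T_b^{(m)}}\ (m\ge1),$$ with $\inf\emptyset=\infty$, and $$R^b_t=\sum_{n\ge1}\bigl(b-\tilde X^{(n-1),b}_{T_b^{(n)}}\bigr)1_{\{T_b^{(n)}\le t\}},\qquad U^b_t=X_t+R^b_t .$$ Let $q>0$ and $C\in\mathbb R$, and let $f:\mathbb R\to\mathbb R$ be convex with $|f(x)|\le k_1+k_2|x|^N$ for all $x\in\mathbb R$, for some constants $k_1,k_2\in\mathbb R$ and $N\in\mathbb N$. Let $f'_+$ be its right-hand derivative, let $f'_+(\pm\infty)=\lim_{x\to\pm\infty}f'_+(x)\in[-\infty,\infty]$, and assume $f'_+(-\infty)<-Cq<f'_+(\infty)$. Define $$\rho(b)=\mathbb E_b\Bigl[\int_0^\infty e^{-qt}f'_+(U^b_t)\,dt\Bigr],\qquad b\in\mathbb R .$$ Then $\rho(b)$ is well defined and finite, with $\mathbb E_b\bigl[\int_0^\infty e^{-qt}|f'_+(U^b_t)|\,dt\bigr]<\infty$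 for every $b\in\mathbb R$, and $\rho$ is nondecreasing and continuous. Moreover, in $[-\infty,\infty]$, $$\lim_{b\to\infty}\rho(b)=\frac{f'_+(\infty)}q>-C,\qquad \lim_{b\to-\infty}\rho(b)=\frac{f'_+(-\infty)}q<-C .$$ In particular $b^*=\inf\{b\in\mathbb R:\rho(b)+C\ge0\}$ is well defined: the set is nonempty and bounded below. -/

import Mathlib

open MeasureTheory ProbabilityTheory Filter Set Topology
open scoped NNReal ENNReal

noncomputable section

namespace PeriodicBarrier

variable {Ω : Type*} [MeasurableSpace Ω]

/-! ### Lévy processes, their triplets, compound Poisson processes -/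

/-- A real-valued Lévy process started at `0`: almost surely càdlàg paths, and stationary and
independent increments. -/
structure IsLevyProcess (X : ℝ≥0 → Ω → ℝ) (P : Measure Ω) : Prop where
  measurable : ∀ t, Measurable (X t)
  zero : ∀ᵐ ω ∂P, X 0 ω = 0
  cadlag : ∀ᵐ ω ∂P, ∀ t, ContinuousWithinAt (fun s => X s ω) (Ici t) t ∧
    ∃ l, Tendsto (fun s => X s ω) (𝓝[<] t) (𝓝 l)
  indep_increments : HasIndepIncrements X P
  stationary : ∀ s t, IdentDistrib (fun ω => X (s + t) ω - X s ω) (X t) P P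

/-- `ν` is a Lévy measure on `ℝ \ {0}`: no mass at `0` and `∫ (1 ∧ z²) ν(dz) < ∞`. -/
structure IsLevyMeasure (ν : Measure ℝ) : Prop where
  zero : ν {0} = 0
  lintegral_lt_top : ∫⁻ z, ENNReal.ofReal (min 1 (z ^ 2)) ∂ν < ∞

/-- The exponent
`Ψ(u) = - i γ u + σ² u² / 2 + ∫ (1 - e^{i u z} + i u z 1_{|z| < 1}) ν(dz)`. -/
def levyExponent (γ σ : ℝ) (ν : Measure ℝ) (u : ℝ) : ℂ :=
  -(Complex.I * γ * u) + (1 / 2 : ℂ) * (σ : ℂ) ^ 2 * (u : ℂ) ^ 2 +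
    ∫ z, (1 - Complex.exp (Complex.I * u * z) +
      Complex.I * u * z * indicator {y : ℝ | |y| < 1} (fun _ => (1 : ℂ)) z) ∂ν

/-- `X` has generating triplet `(γ, σ, ν)`, i.e. `E[e^{i u X_t}] = e^{-t Ψ(u)}` for all `u`, `t`. -/
structure HasLevyTriplet (X : ℝ≥0 → Ω → ℝ) (P : Measure Ω) (γ σ : ℝ) (ν : Measure ℝ) : Prop where
  sigma_nonneg : 0 ≤ σ
  isLevyMeasure : IsLevyMeasure ν
  charFun_eq : ∀ (t : ℝ≥0) (u : ℝ),
    charFun (P.map (X t)) u = Complex.exp (-((t : ℝ) : ℂ) * levyExponent γ σ ν u)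

/-- The compound Poisson law: the law of `Z₁ + ⋯ + Z_N` with `N` Poisson of mean `r`, independent
of the i.i.d. variables `Zᵢ` of law `F`. -/
def compoundPoissonMeasure (r : ℝ≥0) (F : Measure ℝ) : Measure ℝ :=
  Measure.sum fun n : ℕ => poissonMeasure r {n} • (fun μ => F.conv μ)^[n] (Measure.dirac 0)

/-- The Lévy process `X` is a driftless compound Poisson process, with some rate `c ≥ 0` and some
jump law `F` (the zero process, `c = 0`, is included). The law of a Lévy process is determined by
its one-dimensional marginals, so these are all that has to be prescribed. -/
def IsDriftlessCompoundPoisson (X : ℝ≥0 → Ω → ℝ) (P : Measure Ω) : Prop :=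
  ∃ (c : ℝ≥0) (F : Measure ℝ), IsProbabilityMeasure F ∧
    ∀ t : ℝ≥0, P.map (X t) = compoundPoissonMeasure (c * t) F

/-- `T 0 = 0` and `T 1, T 2, …` are the arrival times of a Poisson process of intensity `η`: the
interarrival times are i.i.d. exponential with parameter `η`. -/
structure IsPoissonArrivals (T : ℕ → Ω → ℝ≥0) (η : ℝ) (P : Measure Ω) : Prop where
  measurable : ∀ k, Measurable (T k)
  zero : ∀ ω, T 0 ω = 0
  indep : iIndepFun (fun (k : ℕ) ω => (T (k + 1) ω : ℝ) - (T k ω : ℝ)) P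
  law : ∀ k : ℕ, HasLaw (fun ω => (T (k + 1) ω : ℝ) - (T k ω : ℝ)) (expMeasure η) P

/-! ### The periodic barrier strategy, path by path

Here `x` is a path of the uncontrolled process, `τ 1, τ 2, …` are the control opportunities and `b`
is the barrier. -/

/-- The path `X̃^{(m), b}`, where `S` is the `m`-th control time: the path itself for `m = 0`, and
the path shifted so as to be at `b` at time `S` for `m ≥ 1`. (For `m ≥ 1` it is only relevant when
`S < ∞`.) -/
def restartedPath (b : ℝ) (x : ℝ≥0 → ℝ) (m : ℕ) (S : ℝ≥0∞) (t : ℝ≥0) : ℝ :=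
  if m = 0 then x t else b + (x t - x S.toNNReal)

/-- The control times `T_b^{(n)}`, with `T_b^{(0)} = 0` and `inf ∅ = ∞`. -/
def controlTime (b : ℝ) (x : ℝ≥0 → ℝ) (τ : ℕ → ℝ≥0) : ℕ → ℝ≥0∞
  | 0 => 0
  | n + 1 => sInf {t : ℝ≥0∞ | ∃ k : ℕ, 1 ≤ k ∧ t = (τ k : ℝ≥0∞) ∧ controlTime b x τ n < t ∧
      restartedPath b x n (controlTime b x τ n) (τ k) < b}

/-- The cumulative control
`R^b_t = ∑_{n ≥ 1} (b - X̃^{(n-1), b}_{T_b^{(n)}}) 1_{T_b^{(n)} ≤ t}`. -/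
def periodicControl (b : ℝ) (x : ℝ≥0 → ℝ) (τ : ℕ → ℝ≥0) (t : ℝ≥0) : ℝ :=
  ∑' n : ℕ, indicator {s : ℝ≥0 | controlTime b x τ (n + 1) ≤ s}
    (fun _ => b - restartedPath b x n (controlTime b x τ n) (controlTime b x τ (n + 1)).toNNReal) t

/-- The controlled path `U^b = X + R^b`. -/
def controlledPath (b : ℝ) (x : ℝ≥0 → ℝ) (τ : ℕ → ℝ≥0) (t : ℝ≥0) : ℝ :=
  x t + periodicControl b x τ t

/-! ### The running cost and the function `ρ` -/

/-- The right-hand derivative `f'_+`. -/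
def rightDeriv (f : ℝ → ℝ) (y : ℝ) : ℝ := derivWithin f (Ioi y) y

/-- `f'_+(∞) = lim_{y → ∞} f'_+(y)` as an extended real. -/
def rightDerivAtTop (f : ℝ → ℝ) : EReal := limUnder atTop fun y => (rightDeriv f y : EReal)

/-- `f'_+(-∞) = lim_{y → -∞} f'_+(y)` as an extended real. -/
def rightDerivAtBot (f : ℝ → ℝ) : EReal := limUnder atBot fun y => (rightDeriv f y : EReal)

/-- The integrand `e^{-qt} f'_+(U^b_t)` at the sample point and time `p = (ω, t)`, where the
uncontrolled process starts from `a`, that is, equals `a + X`. -/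
def discountedSlope (X : ℝ≥0 → Ω → ℝ) (T : ℕ → Ω → ℝ≥0) (q : ℝ) (f : ℝ → ℝ) (b a : ℝ)
    (p : Ω × ℝ) : ℝ :=
  Real.exp (-(q * p.2)) *
    rightDeriv f (controlledPath b (fun s => a + X s p.1) (fun k => T k p.1) p.2.toNNReal)

/-- `ρ(b) = E_b[∫_0^∞ e^{-qt} f'_+(U^b_t) dt]`; under `P_b` the uncontrolled process is `b + X`. -/
def rho (X : ℝ≥0 → Ω → ℝ) (T : ℕ → Ω → ℝ≥0) (P : Measure Ω) (q : ℝ) (f : ℝ → ℝ) (b : ℝ) : ℝ :=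
  ∫ ω, (∫ t in Ioi (0 : ℝ), discountedSlope X T q f b b (ω, t)) ∂P

/-- The set `{b : ρ(b) + C ≥ 0}`. -/
def barrierSet (X : ℝ≥0 → Ω → ℝ) (T : ℕ → Ω → ℝ≥0) (P : Measure Ω) (q : ℝ) (f : ℝ → ℝ)
    (C : ℝ) : Set ℝ :=
  {b | 0 ≤ rho X T P q f b + C}

/-- `b* = inf {b : ρ(b) + C ≥ 0}`. -/
def optimalBarrier (X : ℝ≥0 → Ω → ℝ) (T : ℕ → Ω → ℝ≥0) (P : Measure Ω) (q : ℝ) (f : ℝ → ℝ)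
    (C : ℝ) : ℝ :=
  sInf (barrierSet X T P q f C)

end PeriodicBarrier

end

open PeriodicBarrier

noncomputable section

namespace PeriodicBarrier

/-! ### The controlled path between two control opportunities -/

/-! For a path started at its barrier, the barrier cancels from the rule that triggers an
intervention. The controlled path is therefore `b + V`, where `V` is `X` plus the maximum of `0` and
the values of `-X` at the opportunities so far (`controlledPath_eq`), and `V` does not depend on
`b`. Hence `ρ(b)` is the integral of `f'_+(b + V)` against the product of `P` and `e^{-qt} dt`, a
measure of mass `1/q`. Since `f'_+` is nondecreasing, so is `ρ`; truncation and dominated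
convergence give the limits `f'_+(±∞)/q`, and these give the claims on `b*`.

Integrability. `f'_+` grows polynomially, so moments of `V` suffice. The exponential moment of the
Lévy measure makes the exponent analytic near `0`, where it vanishes. Cauchy estimates on a small
disc then give `E|X_t|^N ≤ K e^{at}` for any `a > 0` (`exists_lintegral_pow_le`). With `a = q/2` the
discount wins, and the running maximum, bounded by a sum over arrivals, costs a geometric series
(`integrable_abs_controlledValue_pow`).

Continuity. `f'_+` has countably many discontinuities, so it is enough that `V` has no atoms under
the product measure (`continuous_integral_shift`). After the `k`-th arrival, `V` is the state at
that arrival plus an independent increment of `X`, so the question reduces to atoms of the resolvent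
of `X`, whose characteristic function is `1/(1 + Ψ)`. An atom is at most an asymptotic average of
the modulus of that function. These averages vanish when there is a Gaussian part, when the Lévy
measure is finite with nonzero drift, and when the Lévy measure is infinite. The only case left is a
driftless compound Poisson process (`measure_evalRight_eq_zero`). -/

/-- The running maximum `max (0, -x (τ 1), …, -x (τ k))`. -/
def runningMax (x : ℝ≥0 → ℝ) (τ : ℕ → ℝ≥0) : ℕ → ℝ
  | 0 => 0
  | k + 1 => max (runningMax x τ k) (-x (τ (k + 1)))

lemma runningMax_nonneg (x : ℝ≥0 → ℝ) (τ : ℕ → ℝ≥0) (k : ℕ) : 0 ≤ runningMax x τ k := by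
  induction k with
  | zero => exact le_rfl
  | succ k ih => exact ih.trans (le_max_left _ _)

/-- A maximum of nonnegative terms is at most their sum, which is what can be integrated over random
arrivals. At `k = 0` the exponent must be nonzero, because `0 ^ 0 = 1`. -/
lemma runningMax_pow_le (x : ℝ≥0 → ℝ) (τ : ℕ → ℝ≥0) {N : ℕ} (hN : N ≠ 0) (k : ℕ) :
    runningMax x τ k ^ N ≤ ∑ j ∈ Finset.range k, |x (τ (j + 1))| ^ N := by
  induction k with
  | zero => simp [runningMax, hN]
  | succ k ih =>
    rw [Finset.sum_range_succ]
    have h0 : 0 ≤ ∑ j ∈ Finset.range k, |x (τ (j + 1))| ^ N := by positivity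
    have h1 : 0 ≤ |x (τ (k + 1))| ^ N := by positivity
    rcases le_total (-x (τ (k + 1))) (runningMax x τ k) with h | h
    · rw [runningMax, max_eq_left h]; linarith
    · rw [runningMax, max_eq_right h]
      have h2 : (-x (τ (k + 1))) ^ N ≤ |x (τ (k + 1))| ^ N :=
        pow_le_pow_left₀ ((runningMax_nonneg x τ k).trans h) (neg_le_abs _) N
      linarith

lemma monotone_controlTime (b : ℝ) (x : ℝ≥0 → ℝ) (τ : ℕ → ℝ≥0) :
    Monotone (controlTime b x τ) := by
  refine monotone_nat_of_le_succ fun n => ?_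
  rw [controlTime]
  refine le_sInf ?_
  rintro t ⟨k, -, -, h, -⟩
  exact h.le

/-- The control carried out by the `(n + 1)`-st intervention. -/
def controlJump (b : ℝ) (x : ℝ≥0 → ℝ) (τ : ℕ → ℝ≥0) (n : ℕ) : ℝ :=
  b - restartedPath b x n (controlTime b x τ n) (controlTime b x τ (n + 1)).toNNReal

/-- The barrier cancels: an intervention takes place exactly when `-x` exceeds its value at the last
intervention, so the control does not depend on `b`. -/
lemma restartedPath_lt_iff (b : ℝ) (x : ℝ≥0 → ℝ) (n : ℕ) (S : ℝ≥0∞) (t : ℝ≥0) :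
    restartedPath b (fun s => b + x s) n S t < b ↔
      (if n = 0 then 0 else -x S.toNNReal) < -x t := by
  unfold restartedPath
  split_ifs <;> constructor <;> intro h <;> linarith

lemma controlTime_succ_ge {b : ℝ} {x : ℝ≥0 → ℝ} {τ : ℕ → ℝ≥0} (hτ : StrictMono τ) {n k : ℕ}
    (h1 : (τ k : ℝ≥0∞) ≤ controlTime b x τ n) :
    (τ (k + 1) : ℝ≥0∞) ≤ controlTime b x τ (n + 1) := by
  rw [controlTime]
  refine le_sInf ?_
  rintro t ⟨j, -, rfl, h, -⟩
  have : τ k < τ j := by exact_mod_cast h1.trans_lt h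
  exact_mod_cast hτ.monotone (hτ.lt_iff_lt.1 this)

/-- The state of the control after the `k`-th opportunity: there have been `n` interventions, the
total control is `runningMax`, and the next intervention is not before the next opportunity. -/
lemma exists_control_state (b : ℝ) (x : ℝ≥0 → ℝ) {τ : ℕ → ℝ≥0} (hτ : StrictMono τ)
    (hτ0 : τ 0 = 0) (k : ℕ) :
    ∃ n, controlTime b (fun s => b + x s) τ n ≤ τ k ∧
      (τ (k + 1) : ℝ≥0∞) ≤ controlTime b (fun s => b + x s) τ (n + 1) ∧
      (if n = 0 then 0 else -x (controlTime b (fun s => b + x s) τ n).toNNReal) =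
        runningMax x τ k ∧
      ∑ i ∈ Finset.range n, controlJump b (fun s => b + x s) τ i = runningMax x τ k := by
  induction k with
  | zero =>
    refine ⟨0, by simp [controlTime], controlTime_succ_ge hτ ?_, by simp [runningMax],
      by simp [runningMax]⟩
    simp [hτ0]
  | succ k ih =>
    obtain ⟨n, h1, h2, h3, h4⟩ := ih
    have hlt : controlTime b (fun s => b + x s) τ n < τ (k + 1) :=
      h1.trans_lt (by exact_mod_cast hτ k.lt_succ_self)
    rcases lt_or_ge (runningMax x τ k) (-x (τ (k + 1))) with h | h
    -- A new record of `-x` triggers an intervention at `τ (k + 1)`. Its size is the increase of the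
    -- record, so the sum of the controls telescopes to the new maximum.
    · have heq : controlTime b (fun s => b + x s) τ (n + 1) = τ (k + 1) := by
        refine le_antisymm ?_ h2
        rw [controlTime]
        exact sInf_le ⟨k + 1, by omega, rfl, hlt, (restartedPath_lt_iff ..).2 (h3 ▸ h)⟩
      refine ⟨n + 1, heq.le, controlTime_succ_ge hτ heq.ge, ?_, ?_⟩
      · simp [heq, runningMax, h.le]
      · rw [Finset.sum_range_succ, h4, controlJump, heq, runningMax, max_eq_right h.le, ← h3]
        by_cases hn : n = 0 <;> simp [restartedPath, hn]
        ring
    -- Without a new record `τ (k + 1)` is not admissible, so the lower bound on the next control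
    -- time moves up by one opportunity.
    · refine ⟨n, hlt.le, ?_, by rw [runningMax, max_eq_left h, h3],
        by rw [runningMax, max_eq_left h, h4]⟩
      have h2' := h2
      rw [controlTime] at h2 ⊢
      refine le_sInf ?_
      rintro t ⟨j, hj, rfl, hj1, hj2⟩
      have hkj : τ (k + 1) ≤ τ j := by
        exact_mod_cast h2.trans (sInf_le ⟨j, hj, rfl, hj1, hj2⟩)
      have hkj' : k + 1 ≠ j := by
        rintro rfl
        rw [restartedPath_lt_iff, h3] at hj2
        exact absurd hj2 (not_lt.2 h)
      exact_mod_cast hτ.monotone (lt_of_le_of_ne (hτ.le_iff_le.1 hkj) hkj')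

/-- Between the opportunities `τ k` and `τ (k + 1)` the controlled path started at the barrier is
the uncontrolled one plus the running maximum. -/
lemma controlledPath_eq (b : ℝ) (x : ℝ≥0 → ℝ) {τ : ℕ → ℝ≥0} (hτ : StrictMono τ)
    (hτ0 : τ 0 = 0) {k : ℕ} {t : ℝ≥0} (ht : τ k ≤ t) (ht' : t < τ (k + 1)) :
    controlledPath b (fun s => b + x s) τ t = b + (x t + runningMax x τ k) := by
  obtain ⟨n, h1, h2, h3, h4⟩ := exists_control_state b x hτ hτ0 k
  have hmono := monotone_controlTime b (fun s => b + x s) τ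
  rw [controlledPath, periodicControl, tsum_eq_sum (s := Finset.range n), ← h4, add_assoc]
  · congr 2
    refine Finset.sum_congr rfl fun i hi => ?_
    rw [indicator_of_mem]
    · rfl
    · exact ((hmono (Finset.mem_range.1 hi)).trans h1).trans (by exact_mod_cast ht)
  · intro i hi
    rw [indicator_of_notMem]
    simp only [mem_ofPred_eq, not_le]
    have hni : n + 1 ≤ i + 1 := by simpa using hi
    exact lt_of_lt_of_le (by exact_mod_cast ht') (h2.trans (hmono hni))

/-! ### Integrals of a monotone function along a shift -/

section Shift

variable {S : Type*} [MeasurableSpace S] {m : Measure S} {V : S → ℝ} {g : ℝ → ℝ}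

lemma monotone_integral_shift (hg : Monotone g) (hi : ∀ b, Integrable (fun s => g (b + V s)) m) :
    Monotone fun b => ∫ s, g (b + V s) ∂m := fun a b hab =>
  integral_mono (hi a) (hi b) fun s => hg (by simpa using hab)

/-- Monotonicity bounds `g (a + V)`, for `a` within `1` of `b`, by the values at `b - 1` and `b +
1`. A monotone `g` has countably many discontinuities, and almost surely `b + V` avoids all of them.
-/
lemma continuous_integral_shift (hg : Monotone g) (hi : ∀ b, Integrable (fun s => g (b + V s)) m)
    (hV : ∀ y, ∀ᵐ s ∂m, V s ≠ y) : Continuous fun b => ∫ s, g (b + V s) ∂m := by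
  rw [continuous_iff_continuousAt]
  intro b
  refine continuousAt_of_dominated (F := fun b s => g (b + V s))
    (bound := fun s => |g (b - 1 + V s)| + |g (b + 1 + V s)|)
    (Eventually.of_forall fun a => (hi a).1) ?_ ((hi _).abs.add (hi _).abs) ?_
  · filter_upwards [Icc_mem_nhds (sub_one_lt b) (lt_add_one b)] with a ha
    refine Eventually.of_forall fun s => ?_
    have h1 : g (b - 1 + V s) ≤ g (a + V s) := hg (by linarith [ha.1])
    have h2 : g (a + V s) ≤ g (b + 1 + V s) := hg (by linarith [ha.2])
    rw [Real.norm_eq_abs, abs_le]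
    constructor
    · linarith [neg_abs_le (g (b - 1 + V s)), abs_nonneg (g (b + 1 + V s))]
    · linarith [le_abs_self (g (b + 1 + V s)), abs_nonneg (g (b - 1 + V s))]
  · have hc := hg.countable_not_continuousAt
    have h : ∀ᵐ s ∂m, ∀ y ∈ {y | ¬ ContinuousAt g y}, V s ≠ y - b :=
      (ae_ball_iff hc).2 fun y _ => hV _
    filter_upwards [h] with s hs
    have hs' : ContinuousAt g (b + V s) := by
      by_contra hcon
      exact hs _ hcon (by ring)
    exact ContinuousAt.comp (f := fun a => a + V s) hs' (by fun_prop)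

/-- Since `g ≤ L`, the integral is at most `L / q`. Below, `g` is truncated at a level `g y` close
to `L`, so that dominated convergence applies even when `L = ∞`. -/
lemma tendsto_integral_shift_atTop [IsFiniteMeasure m] {q : ℝ} (hq : 0 < q)
    (hm : m.real univ = 1 / q) (hg : Monotone g)
    (hi : ∀ b, Integrable (fun s => g (b + V s)) m)
    {L : EReal} (hL : Tendsto (fun y => (g y : EReal)) atTop (𝓝 L)) :
    Tendsto (fun b => ((∫ s, g (b + V s) ∂m : ℝ) : EReal)) atTop (𝓝 (L / q)) := by
  have hgL : ∀ y, (g y : EReal) ≤ L := fun y =>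
    Monotone.ge_of_tendsto (fun a b hab => EReal.coe_le_coe_iff.2 (hg hab)) hL y
  have hq0 : (0 : EReal) < q := by exact_mod_cast hq
  refine tendsto_order.2 ⟨fun a ha => ?_, fun a ha => ?_⟩
  · rw [EReal.lt_div_iff hq0 (EReal.coe_ne_top _)] at ha
    obtain ⟨y, hy⟩ := ((tendsto_order.1 hL).1 _ ha).exists
    rw [← EReal.lt_div_iff hq0 (EReal.coe_ne_top _), ← EReal.coe_div] at hy
    have hlim : Tendsto (fun b => ∫ s, min (g (b + V s)) (g y) ∂m) atTop
        (𝓝 (∫ _, g y ∂m)) := by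
      refine tendsto_integral_filter_of_dominated_convergence
        (fun s => |g (0 + V s)| + |g y|)
        (Eventually.of_forall fun b => ((hi b).inf (integrable_const _)).1) ?_
        ((hi 0).abs.add (integrable_const _)) ?_
      · filter_upwards [eventually_ge_atTop 0] with b hb
        refine Eventually.of_forall fun s => ?_
        have h1 : g (0 + V s) ≤ g (b + V s) := hg (by linarith)
        rw [Real.norm_eq_abs, abs_le]
        constructor
        · rw [le_min_iff]
          constructor
          · linarith [neg_abs_le (g (0 + V s)), abs_nonneg (g y)]
          · linarith [neg_abs_le (g y), abs_nonneg (g (0 + V s))]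
        · linarith [min_le_right (g (b + V s)) (g y), le_abs_self (g y), abs_nonneg (g (0 + V s))]
      · refine Eventually.of_forall fun s => tendsto_const_nhds.congr' ?_
        filter_upwards [eventually_ge_atTop (y - V s)] with b hb
        exact (min_eq_right (hg (by linarith))).symm
    rw [integral_const, hm, smul_eq_mul, one_div_mul_eq_div] at hlim
    have h3 := (tendsto_order.1 (EReal.tendsto_coe.2 hlim)).1 _ hy
    filter_upwards [h3] with b hb
    refine hb.trans_le (EReal.coe_le_coe_iff.2 ?_)
    exact integral_mono ((hi b).inf (integrable_const _)) (hi b) fun s => min_le_left _ _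
  · refine Eventually.of_forall fun b => lt_of_le_of_lt ?_ ha
    induction L with
    | bot => exact absurd (hgL 0) (by simp)
    | top => rw [EReal.top_div_of_pos_ne_top hq0 (EReal.coe_ne_top _)]; exact le_top
    | coe L =>
      rw [← EReal.coe_div, EReal.coe_le_coe_iff]
      calc ∫ s, g (b + V s) ∂m ≤ ∫ _, L ∂m :=
            integral_mono (hi b) (integrable_const _) fun s => EReal.coe_le_coe_iff.1 (hgL _)
        _ = L / q := by rw [integral_const, hm, smul_eq_mul, one_div_mul_eq_div]

/-- Reflection: apply the limit at `+∞` to `-g (-·)` and `-V`. -/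
lemma tendsto_integral_shift_atBot [IsFiniteMeasure m] {q : ℝ} (hq : 0 < q)
    (hm : m.real univ = 1 / q) (hg : Monotone g)
    (hi : ∀ b, Integrable (fun s => g (b + V s)) m)
    {L : EReal} (hL : Tendsto (fun y => (g y : EReal)) atBot (𝓝 L)) :
    Tendsto (fun b => ((∫ s, g (b + V s) ∂m : ℝ) : EReal)) atBot (𝓝 (L / q)) := by
  have h := tendsto_integral_shift_atTop (m := m) (V := fun s => -V s) (g := fun y => -g (-y))
    (L := -L) hq hm (fun a b hab => neg_le_neg (hg (neg_le_neg hab)))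
    (fun b => by simpa [neg_add, add_comm] using (hi (-b)).neg)
    (by simpa [Function.comp_def] using hL.comp tendsto_neg_atTop_atBot)
  have h2 := (continuous_neg.tendsto _).comp (h.comp tendsto_neg_atBot_atTop)
  rw [div_eq_mul_inv, EReal.neg_mul, neg_neg, ← div_eq_mul_inv] at h2
  refine h2.congr fun b => ?_
  simp [integral_neg, add_comm]

end Shift

/-! ### The right-hand derivative of a convex function -/

lemma monotone_rightDeriv {f : ℝ → ℝ} (hf : ConvexOn ℝ univ f) : Monotone (rightDeriv f) := by
  have h := hf.monotoneOn_rightDeriv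
  rw [interior_univ] at h
  exact monotoneOn_univ.1 h

/-- `limUnder` is meaningful only if a limit exists; monotonicity in the complete order `EReal`
provides one. -/
lemma tendsto_rightDerivAtTop {f : ℝ → ℝ} (hf : ConvexOn ℝ univ f) :
    Tendsto (fun y => (rightDeriv f y : EReal)) atTop (𝓝 (rightDerivAtTop f)) := by
  have hm : Monotone fun y => (rightDeriv f y : EReal) := fun a b hab =>
    EReal.coe_le_coe_iff.2 (monotone_rightDeriv hf hab)
  exact tendsto_nhds_limUnder ⟨_, tendsto_atTop_iSup hm⟩

lemma tendsto_rightDerivAtBot {f : ℝ → ℝ} (hf : ConvexOn ℝ univ f) :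
    Tendsto (fun y => (rightDeriv f y : EReal)) atBot (𝓝 (rightDerivAtBot f)) := by
  have hm : Monotone fun y => (rightDeriv f y : EReal) := fun a b hab =>
    EReal.coe_le_coe_iff.2 (monotone_rightDeriv hf hab)
  exact tendsto_nhds_limUnder ⟨_, tendsto_atBot_iInf hm⟩

/-- By convexity `f'_+(y)` lies between the slopes of the chords over `[y - 1, y]` and `[y, y + 1]`.
-/
lemma abs_rightDeriv_le {f : ℝ → ℝ} (hf : ConvexOn ℝ univ f) (y : ℝ) :
    |rightDeriv f y| ≤ |f (y + 1)| + |f y| + |f (y - 1)| := by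
  have h1 : rightDeriv f y ≤ f (y + 1) - f y := by
    have := hf.rightDeriv_le_slope_of_mem_interior (x := y) (y := y + 1) (by simp) (by simp)
      (by simp)
    simpa [slope_def_field, rightDeriv] using this
  have h2 : f y - f (y - 1) ≤ rightDeriv f y := by
    have h3 := hf.slope_le_leftDeriv_of_mem_interior (x := y - 1) (y := y) (by simp) (by simp)
      (by simp)
    have h4 := hf.leftDeriv_le_rightDeriv_of_mem_interior (x := y) (by simp)
    have h5 := h3.trans h4
    simpa [slope_def_field, rightDeriv] using h5
  rw [abs_le]
  constructor
  · linarith [neg_abs_le (f y), le_abs_self (f (y - 1)), abs_nonneg (f (y + 1))]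
  · linarith [neg_abs_le (f y), le_abs_self (f (y + 1)), abs_nonneg (f (y - 1))]

/-- The exponent is raised from `N` to `N + 1` so that it is nonzero, as `runningMax_pow_le`
requires. -/
lemma exists_abs_rightDeriv_le {f : ℝ → ℝ} (hf : ConvexOn ℝ univ f)
    (hgrowth : ∃ (k₁ k₂ : ℝ) (N : ℕ), ∀ x, |f x| ≤ k₁ + k₂ * |x| ^ N) :
    ∃ (K : ℝ) (N : ℕ), 0 ≤ K ∧ N ≠ 0 ∧ ∀ y, |rightDeriv f y| ≤ K * (1 + |y| ^ N) := by
  obtain ⟨k₁, k₂, N, h⟩ := hgrowth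
  have hstep : ∀ x y : ℝ, |x| ≤ |y| + 1 →
      |f x| ≤ (|k₁| + |k₂| * 2 ^ (2 * N + 2)) * (1 + |y| ^ (N + 1)) := by
    intro x y hxy
    have h1 : |x| ^ N ≤ 2 ^ (2 * N + 2) * (1 + |y| ^ (N + 1)) := by
      rcases le_total |y| 1 with hy | hy
      · calc |x| ^ N ≤ 2 ^ N := pow_le_pow_left₀ (abs_nonneg _) (by linarith) _
          _ ≤ 2 ^ (2 * N + 2) * 1 := by
            rw [mul_one]; exact pow_le_pow_right₀ (by norm_num) (by omega)
          _ ≤ _ := by gcongr; linarith [pow_nonneg (abs_nonneg y) (N + 1)]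
      · calc |x| ^ N ≤ (2 * |y|) ^ N := pow_le_pow_left₀ (abs_nonneg _) (by linarith) _
          _ = 2 ^ N * |y| ^ N := mul_pow _ _ _
          _ ≤ 2 ^ (2 * N + 2) * (1 + |y| ^ (N + 1)) := by
            gcongr
            · norm_num
            · omega
            · linarith [pow_le_pow_right₀ hy (by omega : N ≤ N + 1)]
    have h2 : 0 ≤ |y| ^ (N + 1) := by positivity
    calc |f x| ≤ k₁ + k₂ * |x| ^ N := h x
      _ ≤ |k₁| + |k₂| * |x| ^ N := by gcongr <;> exact le_abs_self _
      _ ≤ |k₁| * (1 + |y| ^ (N + 1)) + |k₂| * (2 ^ (2 * N + 2) * (1 + |y| ^ (N + 1))) := by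
        gcongr
        exact le_mul_of_one_le_right (abs_nonneg _) (by linarith)
      _ = _ := by ring
  refine ⟨3 * (|k₁| + |k₂| * 2 ^ (2 * N + 2)), N + 1, by positivity, by omega, fun y => ?_⟩
  have h1 := hstep (y + 1) y (by simpa using abs_add_le y 1)
  have h2 := hstep y y (by linarith)
  have h3 := hstep (y - 1) y (by simpa using abs_sub y 1)
  linarith [abs_rightDeriv_le hf y]

/-! ### Moments from an analytic characteristic function -/

/-- The symmetric difference quotient with step `h`. -/
def symmDiffQuot (h : ℝ) (g : ℂ → ℂ) (w : ℂ) : ℂ := (g (w + h) - g (w - h)) / (2 * h)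

/-- The mean value inequality reduces this to a bound on `g'`, which is Cauchy's estimate on circles
of radius `ρ`. The radius shrinks by `ρ` for the step `h` and by `ρ` for the circle. -/
lemma symmDiffQuot_bound {g : ℂ → ℂ} {R M ρ h : ℝ} (hρ : 0 < ρ) (hh : 0 < h) (hhρ : h ≤ ρ)
    (hg : DifferentiableOn ℂ g (Metric.ball 0 R)) (hM : ∀ w ∈ Metric.ball (0 : ℂ) R, ‖g w‖ ≤ M) :
    DifferentiableOn ℂ (symmDiffQuot h g) (Metric.ball 0 (R - 2 * ρ)) ∧
      ∀ w ∈ Metric.ball (0 : ℂ) (R - 2 * ρ), ‖symmDiffQuot h g w‖ ≤ M / ρ := by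
  have hmem : ∀ w ∈ Metric.ball (0 : ℂ) (R - 2 * ρ),
      w + h ∈ Metric.ball (0 : ℂ) (R - ρ) ∧ w - h ∈ Metric.ball (0 : ℂ) (R - ρ) := by
    intro w hw
    rw [mem_ball_zero_iff] at hw
    have hn : ‖(h : ℂ)‖ = h := by simp [hh.le]
    constructor <;> rw [mem_ball_zero_iff]
    · linarith [norm_add_le w h]
    · linarith [norm_sub_le w h]
  have hsub : Metric.ball (0 : ℂ) (R - ρ) ⊆ Metric.ball 0 R := Metric.ball_subset_ball (by linarith)
  constructor
  · refine DifferentiableOn.div_const (DifferentiableOn.sub ?_ ?_) _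
    · exact hg.comp (by fun_prop) fun w hw => hsub (hmem w hw).1
    · exact hg.comp (by fun_prop) fun w hw => hsub (hmem w hw).2
  · intro w hw
    have hderiv : ∀ v ∈ Metric.ball (0 : ℂ) (R - ρ), ‖deriv g v‖ ≤ M / ρ := by
      intro v hv
      rw [mem_ball_zero_iff] at hv
      have hcl : Metric.closedBall v ρ ⊆ Metric.ball 0 R := by
        intro z hz
        rw [mem_closedBall_iff_norm] at hz
        rw [mem_ball_zero_iff]
        have := norm_add_le v (z - v)
        rw [add_sub_cancel] at this
        linarith
      refine Complex.norm_deriv_le_of_forall_mem_sphere_norm_le hρ ?_ fun z hz =>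
        hM z (hcl (Metric.sphere_subset_closedBall hz))
      exact (hg.mono hcl).diffContOnCl_ball subset_rfl
    have h1 := (convex_ball (0 : ℂ) (R - ρ)).norm_image_sub_le_of_norm_deriv_le
      (fun v hv => hg.differentiableAt (Metric.isOpen_ball.mem_nhds (hsub hv))) hderiv
      (hmem w hw).2 (hmem w hw).1
    have h2 : ‖w + h - (w - h)‖ = 2 * h := by
      rw [show w + h - (w - h) = ((2 * h : ℝ) : ℂ) by push_cast; ring, Complex.norm_real,
        Real.norm_of_nonneg (by positivity)]
    have h3 : ‖(2 * h : ℂ)‖ = 2 * h := by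
      rw [show (2 * h : ℂ) = ((2 * h : ℝ) : ℂ) by push_cast; ring, Complex.norm_real,
        Real.norm_of_nonneg (by positivity)]
    rw [symmDiffQuot, norm_div, h3, div_le_iff₀ (by positivity), ← h2]
    exact h1

lemma norm_iterate_symmDiffQuot_le {g : ℂ → ℂ} {R M ρ h : ℝ} (hρ : 0 < ρ) (hh : 0 < h)
    (hhρ : h ≤ ρ) (hg : DifferentiableOn ℂ g (Metric.ball 0 R))
    (hM : ∀ w ∈ Metric.ball (0 : ℂ) R, ‖g w‖ ≤ M) (n : ℕ) :
    DifferentiableOn ℂ ((symmDiffQuot h)^[n] g) (Metric.ball 0 (R - n * (2 * ρ))) ∧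
      ∀ w ∈ Metric.ball (0 : ℂ) (R - n * (2 * ρ)), ‖(symmDiffQuot h)^[n] g w‖ ≤ M / ρ ^ n := by
  induction n with
  | zero => simpa using ⟨hg, fun w hw => hM w (by simpa using hw)⟩
  | succ n ih =>
    have h1 := symmDiffQuot_bound hρ hh hhρ ih.1 ih.2
    rw [Function.iterate_succ_apply', pow_succ, ← div_div]
    convert! h1 using 3
    all_goals (push_cast; ring_nf)

/-- On `e^{iux}`, as a function of `u`, the symmetric difference quotient acts as multiplication by
`i sin(hx)/h`. -/
lemma iterate_symmDiffQuot_eq_integral {g : ℂ → ℂ} {μ : Measure ℝ} [IsFiniteMeasure μ]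
    (hg : ∀ u : ℝ, g u = charFun μ u) {h : ℝ} (hh : h ≠ 0) (n : ℕ) (u : ℝ) :
    (symmDiffQuot h)^[n] g u =
      ∫ x, (Complex.I * ((Real.sin (h * x) / h : ℝ) : ℂ)) ^ n * Complex.exp (u * x * Complex.I)
        ∂μ := by
  induction n generalizing u with
  | zero => simp [hg, charFun_apply_real]
  | succ n ih =>
    have hint : ∀ v : ℝ, Integrable (fun x : ℝ =>
        (Complex.I * ((Real.sin (h * x) / h : ℝ) : ℂ)) ^ n * Complex.exp (v * x * Complex.I)) μ := by
      intro v
      refine Integrable.of_bound (C := (1 / |h|) ^ n) (by fun_prop)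
        (Eventually.of_forall fun x => ?_)
      rw [norm_mul, show (v : ℂ) * x * Complex.I = ((v * x : ℝ) : ℂ) * Complex.I by push_cast; ring,
        Complex.norm_exp_ofReal_mul_I, mul_one, norm_pow, norm_mul, Complex.norm_I, one_mul,
        Complex.norm_real, Real.norm_eq_abs, abs_div]
      gcongr
      exact Real.abs_sin_le_one _
    rw [Function.iterate_succ_apply', symmDiffQuot, ← Complex.ofReal_add, ← Complex.ofReal_sub,
      ih, ih, ← integral_sub (hint _) (hint _), ← integral_div]
    refine integral_congr_ae (Eventually.of_forall fun x => ?_)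
    have hh' : (h : ℂ) ≠ 0 := by exact_mod_cast hh
    have hs : Complex.sin (h * x) =
        (Complex.exp (h * x * Complex.I) - Complex.exp (-(h * x * Complex.I))) /
          (2 * Complex.I) := by
      rw [Complex.sin, neg_mul]
      field_simp
      linear_combination (Complex.exp (-(h * x * Complex.I)) - Complex.exp (h * x * Complex.I)) *
        Complex.I_sq
    have e1 : Complex.exp (((u + h : ℝ) : ℂ) * x * Complex.I) =
        Complex.exp (u * x * Complex.I) * Complex.exp (h * x * Complex.I) := by
      rw [← Complex.exp_add]; push_cast; ring_nf
    have e2 : Complex.exp (((u - h : ℝ) : ℂ) * x * Complex.I) =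
        Complex.exp (u * x * Complex.I) * Complex.exp (-(h * x * Complex.I)) := by
      rw [← Complex.exp_add]; push_cast; ring_nf
    simp only [e1, e2, pow_succ]
    push_cast
    rw [hs]
    field_simp

/-- If the characteristic function of `μ` extends to an analytic function bounded by `M` on a disc,
then the moments of `μ` are bounded by multiples of `M`. -/
lemma lintegral_pow_le_of_charFun {g : ℂ → ℂ} {μ : Measure ℝ} [IsFiniteMeasure μ]
    (hgμ : ∀ u : ℝ, g u = charFun μ u) {R M : ℝ} (hR : 0 < R)
    (hg : DifferentiableOn ℂ g (Metric.ball 0 R)) (hM : ∀ w ∈ Metric.ball (0 : ℂ) R, ‖g w‖ ≤ M)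
    (n : ℕ) :
    ∫⁻ x, ENNReal.ofReal (x ^ (2 * n)) ∂μ ≤
      ENNReal.ofReal (M / (R / (4 * n + 1)) ^ (2 * n)) := by
  -- `2n` difference quotients cost `2ρ` each; this choice leaves the radius `R - 4nρ = ρ > 0`, so
  -- the bound holds at `0`.
  set ρ := R / (4 * n + 1) with hρdef
  have hρ : 0 < ρ := by positivity
  have hbound : ∀ h : ℝ, 0 < h → h ≤ ρ →
      ∫⁻ x, ENNReal.ofReal ((Real.sin (h * x) / h) ^ (2 * n)) ∂μ ≤
        ENNReal.ofReal (M / ρ ^ (2 * n)) := by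
    intro h hh hhρ
    have h1 := (norm_iterate_symmDiffQuot_le hρ hh hhρ hg hM (2 * n)).2 0 (by
      rw [mem_ball_zero_iff, norm_zero]
      have : R = (4 * n + 1) * ρ := by rw [hρdef]; field_simp
      push_cast
      linarith)
    have h2 := iterate_symmDiffQuot_eq_integral hgμ hh.ne' (2 * n) 0
    rw [Complex.ofReal_zero] at h2
    have h3 : (∫ x, (Complex.I * ((Real.sin (h * x) / h : ℝ) : ℂ)) ^ (2 * n) *
        Complex.exp (0 * x * Complex.I) ∂μ) =
        (-1) ^ n * ((∫ x, (Real.sin (h * x) / h) ^ (2 * n) ∂μ : ℝ) : ℂ) := by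
      rw [← integral_complex_ofReal, ← integral_const_mul]
      refine integral_congr_ae (Eventually.of_forall fun x => ?_)
      simp only [zero_mul, Complex.exp_zero, mul_one, mul_pow, pow_mul, Complex.I_sq]
      push_cast
      rfl
    rw [h2, h3, norm_mul, norm_pow, norm_neg, norm_one, one_pow, one_mul, Complex.norm_real] at h1
    rw [← ofReal_integral_eq_lintegral_ofReal]
    · exact ENNReal.ofReal_le_ofReal ((le_abs_self _).trans h1)
    · refine Integrable.of_bound (C := (1 / |h|) ^ (2 * n)) (by fun_prop)
        (Eventually.of_forall fun x => ?_)
      rw [norm_pow, Real.norm_eq_abs, abs_div]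
      gcongr
      exact Real.abs_sin_le_one _
    · exact Eventually.of_forall fun x => (even_two_mul n).pow_nonneg _
  have hlim : ∀ x : ℝ, Tendsto (fun k : ℕ =>
      ENNReal.ofReal ((Real.sin ((1 / ((k : ℝ) + 1)) * x) / (1 / ((k : ℝ) + 1))) ^ (2 * n))) atTop
      (𝓝 (ENNReal.ofReal (x ^ (2 * n)))) := by
    intro x
    refine ENNReal.tendsto_ofReal (Tendsto.pow ?_ _)
    have hd : HasDerivAt (fun h : ℝ => Real.sin (h * x)) x 0 := by
      simpa using ((hasDerivAt_id (0 : ℝ)).mul_const x).sin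
    have h4 : Tendsto (fun k : ℕ => 1 / ((k : ℝ) + 1)) atTop (𝓝[≠] 0) :=
      tendsto_nhdsWithin_of_tendsto_nhds_of_eventually_within _
        tendsto_one_div_add_atTop_nhds_zero_nat (Eventually.of_forall fun k => by
          simp only [mem_compl_iff, mem_singleton_iff]; positivity)
    have h5 := (hasDerivAt_iff_tendsto_slope.1 hd).comp h4
    refine h5.congr fun k => ?_
    simp [slope_def_field]
  -- Fatou's lemma along `h = 1/(k + 1)`, where `sin(hx)/h → x`.
  calc ∫⁻ x, ENNReal.ofReal (x ^ (2 * n)) ∂μ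
      = ∫⁻ x, liminf (fun k : ℕ => ENNReal.ofReal
          ((Real.sin ((1 / ((k : ℝ) + 1)) * x) / (1 / ((k : ℝ) + 1))) ^ (2 * n))) atTop ∂μ :=
        lintegral_congr fun x => (hlim x).liminf_eq.symm
    _ ≤ liminf (fun k : ℕ => ∫⁻ x, ENNReal.ofReal
          ((Real.sin ((1 / ((k : ℝ) + 1)) * x) / (1 / ((k : ℝ) + 1))) ^ (2 * n)) ∂μ) atTop :=
        lintegral_liminf_le fun k => by fun_prop
    _ ≤ ENNReal.ofReal (M / ρ ^ (2 * n)) := by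
        refine liminf_le_of_frequently_le' (Eventually.frequently ?_)
        have := (tendsto_order.1 (tendsto_one_div_add_atTop_nhds_zero_nat (𝕜 := ℝ))).2 ρ hρ
        filter_upwards [this] with k hk
        exact hbound _ (by positivity) hk.le

/-! ### The Lévy exponent in the complex domain -/

/-- The integrand of the Lévy exponent at a complex argument. -/
def levyIntegrand (w : ℂ) (z : ℝ) : ℂ :=
  1 - Complex.exp (Complex.I * w * z) +
    Complex.I * w * z * indicator {y : ℝ | |y| < 1} (fun _ => (1 : ℂ)) z

/-- The Lévy exponent at a complex argument. -/
def complexExponent (γ σ : ℝ) (ν : Measure ℝ) (w : ℂ) : ℂ :=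
  -(Complex.I * γ * w) + (1 / 2 : ℂ) * (σ : ℂ) ^ 2 * w ^ 2 + ∫ z, levyIntegrand w z ∂ν

lemma levyExponent_eq (γ σ : ℝ) (ν : Measure ℝ) (u : ℝ) :
    levyExponent γ σ ν u = complexExponent γ σ ν u := rfl

lemma measurableSet_abs_lt_one : MeasurableSet {y : ℝ | |y| < 1} :=
  measurableSet_lt (by fun_prop) (by fun_prop)

lemma measurable_levyIntegrand (w : ℂ) : Measurable (levyIntegrand w) := by
  have : Measurable (indicator {y : ℝ | |y| < 1} (fun _ => (1 : ℂ))) :=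
    measurable_const.indicator measurableSet_abs_lt_one
  unfold levyIntegrand
  fun_prop

/-- The derivative of `levyIntegrand` in its complex argument. -/
def levyIntegrandDeriv (w : ℂ) (z : ℝ) : ℂ :=
  -(Complex.exp (Complex.I * w * z) * (Complex.I * z)) +
    Complex.I * z * indicator {y : ℝ | |y| < 1} (fun _ => (1 : ℂ)) z

lemma measurable_levyIntegrandDeriv (w : ℂ) : Measurable (levyIntegrandDeriv w) := by
  have : Measurable (indicator {y : ℝ | |y| < 1} (fun _ => (1 : ℂ))) :=
    measurable_const.indicator measurableSet_abs_lt_one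
  unfold levyIntegrandDeriv
  fun_prop

lemma hasDerivAt_levyIntegrand (w : ℂ) (z : ℝ) :
    HasDerivAt (fun w => levyIntegrand w z) (levyIntegrandDeriv w z) w := by
  have h1 : HasDerivAt (fun w : ℂ => Complex.I * w * z) (Complex.I * z) w := by
    simpa using ((hasDerivAt_id w).const_mul Complex.I).mul_const (z : ℂ)
  exact (h1.cexp.const_sub 1).add (h1.mul_const _)

/-- An integrable bound for `levyIntegrandDeriv` on the disc of radius `θ / 2`. -/
def levyBound (θ : ℝ) (z : ℝ) : ℝ :=
  θ / 2 * Real.exp (θ / 2) * min 1 (z ^ 2) +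
    indicator {z : ℝ | 1 ≤ |z|} (fun z => 2 / θ * Real.exp (θ * |z|)) z

lemma integrable_min_one_sq {ν : Measure ℝ} (hν : IsLevyMeasure ν) :
    Integrable (fun z : ℝ => min 1 (z ^ 2)) ν :=
  ⟨by fun_prop, (hasFiniteIntegral_iff_ofReal (Eventually.of_forall fun z => by positivity)).2
    hν.lintegral_lt_top⟩

lemma integrable_levyBound {ν : Measure ℝ} (hν : IsLevyMeasure ν) {θ : ℝ}
    (hexp : ∫⁻ z in {z : ℝ | 1 ≤ |z|}, ENNReal.ofReal (Real.exp (θ * |z|)) ∂ν < ∞) :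
    Integrable (levyBound θ) ν := by
  refine ((integrable_min_one_sq hν).const_mul _).add ?_
  rw [integrable_indicator_iff (measurableSet_le (by fun_prop) (by fun_prop))]
  refine Integrable.const_mul ⟨by fun_prop, ?_⟩ _
  exact (hasFiniteIntegral_iff_ofReal (Eventually.of_forall fun z => by positivity)).2 hexp

lemma norm_I_mul_mul_le {w : ℂ} {r : ℝ} (hw : ‖w‖ ≤ r) (z : ℝ) :
    ‖Complex.I * w * z‖ ≤ r * |z| := by
  rw [norm_mul, norm_mul, Complex.norm_I, one_mul, Complex.norm_real, Real.norm_eq_abs]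
  gcongr

/-- For small jumps the compensator leaves `-iz(e^{iwz} - 1)`, of order `z²`. For large jumps the
exponential uses only half of the rate `θ`, and the other half absorbs the factor `|z|`. -/
lemma norm_levyIntegrandDeriv_le {θ : ℝ} (hθ : 0 < θ) {w : ℂ} (hw : ‖w‖ ≤ θ / 2) (z : ℝ) :
    ‖levyIntegrandDeriv w z‖ ≤ levyBound θ z := by
  have hwz := norm_I_mul_mul_le hw z
  rcases lt_or_ge |z| 1 with hz | hz
  · have h1 : min 1 (z ^ 2) = |z| * |z| := by
      rw [min_eq_right (by rw [← sq_abs]; nlinarith [abs_nonneg z]), ← sq_abs, sq]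
    have h2 := Complex.norm_exp_sub_sum_le_norm_mul_exp (Complex.I * w * z) 1
    simp only [Finset.range_one, Finset.sum_singleton, pow_zero, Nat.factorial_zero, Nat.cast_one,
      div_one, pow_one] at h2
    rw [levyIntegrandDeriv, levyBound, indicator_of_mem (show z ∈ {y : ℝ | |y| < 1} from hz),
      indicator_of_notMem (show z ∉ {z : ℝ | 1 ≤ |z|} from not_le.2 hz), add_zero, h1,
      show -(Complex.exp (Complex.I * w * z) * (Complex.I * z)) + Complex.I * z * 1 =
        -((Complex.I * z) * (Complex.exp (Complex.I * w * z) - 1)) by ring, norm_neg, norm_mul,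
      norm_mul, Complex.norm_I, one_mul, Complex.norm_real, Real.norm_eq_abs]
    calc |z| * ‖Complex.exp (Complex.I * w * z) - 1‖
        ≤ |z| * (θ / 2 * |z| * Real.exp (θ / 2)) := by
          gcongr
          refine h2.trans ?_
          gcongr
          nlinarith [abs_nonneg z]
      _ = _ := by ring
  · rw [levyIntegrandDeriv, levyBound,
      indicator_of_notMem (show z ∉ {y : ℝ | |y| < 1} from not_lt.2 hz),
      indicator_of_mem (show z ∈ {z : ℝ | 1 ≤ |z|} from hz), mul_zero, add_zero, norm_neg, norm_mul,
      norm_mul, Complex.norm_I, one_mul, Complex.norm_real, Real.norm_eq_abs]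
    have h1 : 0 ≤ θ / 2 * Real.exp (θ / 2) * min 1 (z ^ 2) := by positivity
    have h2 : |z| ≤ 2 / θ * Real.exp (θ / 2 * |z|) := by
      have := Real.add_one_le_exp (θ / 2 * |z|)
      rw [div_mul_eq_mul_div, le_div_iff₀ hθ]
      nlinarith
    have h3 : ‖Complex.exp (Complex.I * w * z)‖ ≤ Real.exp (θ / 2 * |z|) := by
      rw [Complex.norm_exp]
      exact Real.exp_le_exp.2 ((Complex.re_le_norm _).trans hwz)
    calc ‖Complex.exp (Complex.I * w * z)‖ * |z|
        ≤ Real.exp (θ / 2 * |z|) * (2 / θ * Real.exp (θ / 2 * |z|)) := by gcongr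
      _ = 2 / θ * Real.exp (θ * |z|) := by
        rw [show θ * |z| = θ / 2 * |z| + θ / 2 * |z| by ring, Real.exp_add]; ring
      _ ≤ _ := by linarith

/-- The integrand vanishes at `w = 0`, so the mean value inequality turns the bound on its
derivative into a bound on the integrand. -/
lemma integrable_levyIntegrand_of_norm_lt {ν : Measure ℝ} (hν : IsLevyMeasure ν) {θ : ℝ}
    (hθ : 0 < θ)
    (hexp : ∫⁻ z in {z : ℝ | 1 ≤ |z|}, ENNReal.ofReal (Real.exp (θ * |z|)) ∂ν < ∞)
    {w : ℂ} (hw : ‖w‖ < θ / 2) : Integrable (levyIntegrand w) ν := by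
  refine ((integrable_levyBound hν hexp).mul_const ‖w‖).mono'
    (measurable_levyIntegrand w).aestronglyMeasurable (Eventually.of_forall fun z => ?_)
  have h := (convex_ball (0 : ℂ) (θ / 2)).norm_image_sub_le_of_norm_hasDerivWithin_le
    (f := fun w => levyIntegrand w z) (x := 0) (y := w)
    (fun v _ => (hasDerivAt_levyIntegrand v z).hasDerivWithinAt)
    (fun v hv => norm_levyIntegrandDeriv_le hθ (mem_ball_zero_iff.1 hv).le z)
    (by simpa using hθ) (by simpa using hw)
  simpa [levyIntegrand] using h

lemma differentiableOn_complexExponent {γ σ : ℝ} {ν : Measure ℝ} (hν : IsLevyMeasure ν) {θ : ℝ}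
    (hθ : 0 < θ)
    (hexp : ∫⁻ z in {z : ℝ | 1 ≤ |z|}, ENNReal.ofReal (Real.exp (θ * |z|)) ∂ν < ∞) :
    DifferentiableOn ℂ (complexExponent γ σ ν) (Metric.ball 0 (θ / 2)) := by
  intro w hw
  have h := hasDerivAt_integral_of_dominated_loc_of_deriv_le (μ := ν) (F := levyIntegrand)
    (F' := levyIntegrandDeriv) (x₀ := w) (bound := levyBound θ)
    (Metric.isOpen_ball.mem_nhds hw)
    (Eventually.of_forall fun v => (measurable_levyIntegrand v).aestronglyMeasurable)
    (integrable_levyIntegrand_of_norm_lt hν hθ hexp (mem_ball_zero_iff.1 hw))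
    (measurable_levyIntegrandDeriv w).aestronglyMeasurable
    (Eventually.of_forall fun z v hv =>
      norm_levyIntegrandDeriv_le hθ (mem_ball_zero_iff.1 hv).le z)
    (integrable_levyBound hν hexp)
    (Eventually.of_forall fun z v _ => hasDerivAt_levyIntegrand v z)
  refine DifferentiableAt.differentiableWithinAt ?_
  exact DifferentiableAt.add (by fun_prop) h.2.differentiableAt

/-- The moments of a Lévy process whose Lévy measure has exponential moments grow subexponentially
in time. -/
lemma exists_lintegral_pow_le {Ω : Type*} [MeasurableSpace Ω] {P : Measure Ω}
    [IsProbabilityMeasure P] {X : ℝ≥0 → Ω → ℝ} {γ σ : ℝ} {ν : Measure ℝ}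
    (hX : ∀ t, Measurable (X t)) (hν : HasLevyTriplet X P γ σ ν) {θ : ℝ} (hθ : 0 < θ)
    (hexp : ∫⁻ z in {z : ℝ | 1 ≤ |z|}, ENNReal.ofReal (Real.exp (θ * |z|)) ∂ν < ∞)
    {a : ℝ} (ha : 0 < a) (N : ℕ) :
    ∃ K : ℝ, 0 ≤ K ∧ ∀ t : ℝ≥0,
      ∫⁻ ω, ENNReal.ofReal (|X t ω| ^ N) ∂P ≤ ENNReal.ofReal (K * Real.exp (a * t)) := by
  have hd := differentiableOn_complexExponent (γ := γ) (σ := σ) hν.isLevyMeasure hθ hexp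
  have hΨ0 : complexExponent γ σ ν 0 = 0 := by simp [complexExponent, levyIntegrand]
  have hcont : ContinuousAt (complexExponent γ σ ν) 0 :=
    (hd.differentiableAt (Metric.ball_mem_nhds 0 (by positivity))).continuousAt
  -- As the exponent vanishes at `0`, there is a disc on which its modulus is below `a`. The disc
  -- does not depend on `t`, and on it `|e^{-tΨ}| ≤ e^{at}`.
  obtain ⟨δ, hδ, hδ'⟩ := Metric.continuousAt_iff.1 hcont a ha
  set R := min δ (θ / 2) with hRdef
  have hR : 0 < R := by positivity
  refine ⟨1 + 1 / (R / (4 * N + 1)) ^ (2 * N), by positivity, fun t => ?_⟩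
  have hbd : ∀ w ∈ Metric.ball (0 : ℂ) R,
      ‖Complex.exp (-((t : ℝ) : ℂ) * complexExponent γ σ ν w)‖ ≤ Real.exp (a * t) := by
    intro w hw
    rw [mem_ball_zero_iff] at hw
    have h1 : ‖complexExponent γ σ ν w‖ < a := by
      simpa [hΨ0] using hδ' (x := w) (by simpa using hw.trans_le (min_le_left _ _))
    rw [Complex.norm_exp]
    refine Real.exp_le_exp.2 ((Complex.re_le_norm _).trans ?_)
    rw [norm_mul, norm_neg, Complex.norm_real, Real.norm_of_nonneg t.coe_nonneg, mul_comm]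
    exact mul_le_mul_of_nonneg_right h1.le t.coe_nonneg
  have hdiff : DifferentiableOn ℂ
      (fun w => Complex.exp (-((t : ℝ) : ℂ) * complexExponent γ σ ν w)) (Metric.ball 0 R) :=
    ((hd.mono (Metric.ball_subset_ball (min_le_right _ _))).const_mul _).cexp
  have : IsProbabilityMeasure (P.map (X t)) := Measure.isProbabilityMeasure_map (hX t).aemeasurable
  have h2 := lintegral_pow_le_of_charFun (μ := P.map (X t))
    (fun u => by rw [hν.charFun_eq, levyExponent_eq]) hR hdiff hbd N
  rw [lintegral_map (by fun_prop) (hX t)] at h2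
  calc ∫⁻ ω, ENNReal.ofReal (|X t ω| ^ N) ∂P
      ≤ ∫⁻ ω, 1 + ENNReal.ofReal (X t ω ^ (2 * N)) ∂P := by
        refine lintegral_mono fun ω => ?_
        rw [← ENNReal.ofReal_one, ← ENNReal.ofReal_add zero_le_one ((even_two_mul N).pow_nonneg _)]
        refine ENNReal.ofReal_le_ofReal ?_
        rw [← (even_two_mul N).pow_abs, mul_comm 2 N, pow_mul]
        -- `r ≤ 1 + r²` with `r = |X t ω| ^ N` passes from arbitrary to even moments.
        nlinarith [sq_nonneg (|X t ω| ^ N - 1)]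
    _ = 1 + ∫⁻ ω, ENNReal.ofReal (X t ω ^ (2 * N)) ∂P := by
        rw [lintegral_add_left measurable_const]; simp
    _ ≤ ENNReal.ofReal 1 + ENNReal.ofReal (Real.exp (a * t) / (R / (4 * N + 1)) ^ (2 * N)) := by
        rw [ENNReal.ofReal_one]; gcongr
    _ = ENNReal.ofReal (1 + Real.exp (a * t) / (R / (4 * N + 1)) ^ (2 * N)) :=
        (ENNReal.ofReal_add zero_le_one (by positivity)).symm
    _ ≤ _ := by
        refine ENNReal.ofReal_le_ofReal ?_
        have : 1 ≤ Real.exp (a * t) := Real.one_le_exp (by positivity)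
        rw [add_mul, one_mul, one_div_mul_eq_div]
        gcongr

/-! ### Atoms of a finite measure and averages of its characteristic function -/

/-- The kernel `∫₀¹ e^{i a v} da`. -/
def meanKernel (v : ℝ) : ℂ := ∫ a in Ioc (0 : ℝ) 1, Complex.exp ((a * v : ℝ) * Complex.I)

lemma norm_meanKernel_le_one (v : ℝ) : ‖meanKernel v‖ ≤ 1 := by
  have h := norm_setIntegral_le_of_norm_le_const (μ := volume) (s := Ioc (0 : ℝ) 1) (C := 1)
    (f := fun a : ℝ => Complex.exp ((a * v : ℝ) * Complex.I)) (by simp)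
    (fun a _ => (Complex.norm_exp_ofReal_mul_I _).le)
  simpa [meanKernel] using h

lemma measurable_meanKernel : Measurable meanKernel := by
  have h : StronglyMeasurable (fun p : ℝ × ℝ => Complex.exp ((p.2 * p.1 : ℝ) * Complex.I)) := by
    refine Continuous.stronglyMeasurable ?_
    fun_prop
  exact (h.integral_prod_right (ν := volume.restrict (Ioc (0 : ℝ) 1))).measurable

lemma norm_meanKernel_le {v : ℝ} (hv : v ≠ 0) : ‖meanKernel v‖ ≤ 2 / |v| := by
  have hv' : (v : ℂ) ≠ 0 := by exact_mod_cast hv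
  have h1 : meanKernel v = (Complex.exp ((v : ℝ) * Complex.I) - 1) / (v * Complex.I) := by
    rw [meanKernel, ← intervalIntegral.integral_of_le zero_le_one]
    have := integral_exp_mul_complex (a := 0) (b := 1) (c := v * Complex.I)
      (by simp [hv'])
    simp only [Complex.ofReal_one, mul_one, Complex.ofReal_zero, mul_zero, Complex.exp_zero] at this
    rw [← this]
    refine intervalIntegral.integral_congr fun a _ => ?_
    push_cast
    ring_nf
  rw [h1, norm_div, norm_mul, Complex.norm_I, mul_one, Complex.norm_real, Real.norm_eq_abs]
  gcongr
  calc _ ≤ ‖Complex.exp ((v : ℝ) * Complex.I)‖ + ‖(1 : ℂ)‖ := norm_sub_le _ _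
    _ = 2 := by rw [Complex.norm_exp_ofReal_mul_I, norm_one]; norm_num

/-- By Fubini the average is the integral of `meanKernel (n (x - y))`. This kernel equals `1` at `x
= y` and tends to `0` elsewhere, so the limit retains only the atom. -/
lemma tendsto_average_charFun (μ : Measure ℝ) [IsFiniteMeasure μ] (y : ℝ) :
    Tendsto (fun n : ℕ => ∫ a in Ioc (0 : ℝ) 1,
      Complex.exp ((-(n * a * y) : ℝ) * Complex.I) * charFun μ (n * a)) atTop
      (𝓝 (μ.real {y} : ℂ)) := by
  have h1 : ∀ n : ℕ, (∫ a in Ioc (0 : ℝ) 1,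
      Complex.exp ((-(n * a * y) : ℝ) * Complex.I) * charFun μ (n * a)) =
      ∫ x, meanKernel (n * (x - y)) ∂μ := by
    intro n
    have hint : Integrable (Function.uncurry fun a x : ℝ =>
        Complex.exp ((a * (n * (x - y)) : ℝ) * Complex.I))
        ((volume.restrict (Ioc (0 : ℝ) 1)).prod μ) := by
      refine Integrable.of_bound (C := 1) (Continuous.aestronglyMeasurable ?_)
        (Eventually.of_forall fun p => (Complex.norm_exp_ofReal_mul_I _).le)
      unfold Function.uncurry
      fun_prop
    calc _ = ∫ a in Ioc (0 : ℝ) 1, ∫ x, Complex.exp ((a * (n * (x - y)) : ℝ) * Complex.I) ∂μ := by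
          refine integral_congr_ae (Eventually.of_forall fun a => ?_)
          simp only [charFun_apply_real]
          rw [← integral_const_mul]
          refine integral_congr_ae (Eventually.of_forall fun x => ?_)
          simp only [← Complex.exp_add]
          push_cast
          ring_nf
      _ = _ := integral_integral_swap hint
  simp_rw [h1]
  have h2 : (μ.real {y} : ℂ) = ∫ x, indicator {y} (fun _ => (1 : ℂ)) x ∂μ := by
    rw [integral_indicator_const _ (measurableSet_singleton y)]
    simp
  rw [h2]
  refine tendsto_integral_of_dominated_convergence (fun _ => 1)
    (fun n => (measurable_meanKernel.comp (by fun_prop)).aestronglyMeasurable)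
    (integrable_const _) (fun n => Eventually.of_forall fun x => norm_meanKernel_le_one _)
    (Eventually.of_forall fun x => ?_)
  by_cases hx : x = y
  · simp [hx, meanKernel]
  · rw [indicator_of_notMem (by simpa using hx)]
    have hx' : 0 < |x - y| := abs_pos.2 (sub_ne_zero.2 hx)
    have h3 : Tendsto (fun n : ℕ => 2 / (n * |x - y|)) atTop (𝓝 0) :=
      tendsto_const_nhds.div_atTop (tendsto_natCast_atTop_atTop.atTop_mul_const hx')
    refine squeeze_zero_norm' ?_ h3
    filter_upwards [eventually_gt_atTop 0] with n hn
    have h4 := norm_meanKernel_le (v := n * (x - y))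
      (mul_ne_zero (by exact_mod_cast hn.ne') (sub_ne_zero.2 hx))
    rwa [abs_mul, Nat.abs_cast] at h4

lemma measureReal_singleton_le_of_average_charFun {μ : Measure ℝ} [IsFiniteMeasure μ] {B : ℝ}
    (h : ∀ᶠ n : ℕ in atTop, ∫ a in Ioc (0 : ℝ) 1, ‖charFun μ (n * a)‖ ≤ B) (y : ℝ) :
    μ.real {y} ≤ B := by
  have h1 := (tendsto_average_charFun μ y).norm
  rw [Complex.norm_real, Real.norm_of_nonneg measureReal_nonneg] at h1
  refine le_of_tendsto h1 ?_
  filter_upwards [h] with n hn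
  refine (norm_integral_le_integral_norm _).trans (le_trans (le_of_eq ?_) hn)
  refine integral_congr_ae (Eventually.of_forall fun a => ?_)
  simp only [norm_mul, Complex.norm_exp_ofReal_mul_I, one_mul]

lemma measureReal_singleton_eq_zero_of_tendsto {μ : Measure ℝ} [IsFiniteMeasure μ]
    (h : Tendsto (fun u => ‖charFun μ u‖) atTop (𝓝 0)) (y : ℝ) : μ.real {y} = 0 := by
  have h1 : Tendsto (fun n : ℕ => ∫ a in Ioc (0 : ℝ) 1, ‖charFun μ (n * a)‖) atTop
      (𝓝 (∫ a in Ioc (0 : ℝ) 1, (0 : ℝ))) := by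
    refine tendsto_integral_of_dominated_convergence (fun _ => μ.real univ)
      (fun n => (measurable_charFun.comp (by fun_prop)).norm.aestronglyMeasurable)
      (integrable_const _) (fun n => Eventually.of_forall fun x => ?_) ?_
    · rw [norm_norm]; exact norm_charFun_le _
    · filter_upwards [ae_restrict_mem measurableSet_Ioc] with a ha
      exact h.comp (tendsto_natCast_atTop_atTop.atTop_mul_const ha.1)
  rw [integral_zero] at h1
  refine le_antisymm (le_of_forall_pos_le_add fun ε hε => ?_) measureReal_nonneg
  rw [zero_add]
  exact measureReal_singleton_le_of_average_charFun
    (((tendsto_order.1 h1).2 ε hε).mono fun n hn => hn.le) y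

/-! ### Averages of `1 / (1 + c (1 - cos v))` -/

/-- The function `1 / (1 + c (1 - cos v))`. -/
def cosKernel (c v : ℝ) : ℝ := 1 / (1 + c * (1 - Real.cos v))

lemma one_le_cosKernel_denom {c : ℝ} (hc : 0 ≤ c) (v : ℝ) : 1 ≤ 1 + c * (1 - Real.cos v) := by
  have := mul_nonneg hc (sub_nonneg.2 (Real.cos_le_one v))
  linarith

lemma cosKernel_nonneg {c : ℝ} (hc : 0 ≤ c) (v : ℝ) : 0 ≤ cosKernel c v :=
  div_nonneg zero_le_one (zero_le_one.trans (one_le_cosKernel_denom hc v))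

lemma cosKernel_le_one {c : ℝ} (hc : 0 ≤ c) (v : ℝ) : cosKernel c v ≤ 1 :=
  (div_le_one (zero_lt_one.trans_le (one_le_cosKernel_denom hc v))).2 (one_le_cosKernel_denom hc v)

lemma continuous_cosKernel {c : ℝ} (hc : 0 ≤ c) : Continuous (cosKernel c) :=
  continuous_const.div (by fun_prop) fun v =>
    (zero_lt_one.trans_le (one_le_cosKernel_denom hc v)).ne'

/-- The integral of `cosKernel c` over a period. -/
def cosKernelMass (c : ℝ) : ℝ := ∫ v in (0 : ℝ)..(2 * Real.pi), cosKernel c v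

lemma cosKernelMass_nonneg {c : ℝ} (hc : 0 ≤ c) : 0 ≤ cosKernelMass c :=
  intervalIntegral.integral_nonneg (by positivity) fun v _ => cosKernel_nonneg hc v

/-- After the substitution `v = a|s|` the interval `[0, |s|]` is covered by whole periods. As `|s| ≥
1`, at most `2|s|` of them are needed, uniformly in `s`. -/
lemma average_cosKernel_le {c : ℝ} (hc : 0 ≤ c) {s : ℝ} (hs : 1 ≤ |s|) :
    ∫ a in Ioc (0 : ℝ) 1, cosKernel c (a * s) ≤ 2 * cosKernelMass c := by
  have hcont := continuous_cosKernel hc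
  have habs : ∀ a, cosKernel c (a * s) = cosKernel c (a * |s|) := by
    intro a
    rcases abs_cases s with ⟨h, -⟩ | ⟨h, -⟩ <;> simp [h, cosKernel]
  have hs0 : 0 < |s| := zero_lt_one.trans_le hs
  have hper : Function.Periodic (cosKernel c) (2 * Real.pi) := fun v => by
    simp [cosKernel]
  have hpi : 0 < 2 * Real.pi := by positivity
  set m := ⌈|s| / (2 * Real.pi)⌉₊ with hm
  have hm1 : |s| ≤ m * (2 * Real.pi) := (div_le_iff₀ hpi).1 (Nat.le_ceil _)
  have hm2 : (m : ℝ) ≤ 2 * |s| := by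
    have h1 : (m : ℝ) < |s| / (2 * Real.pi) + 1 := Nat.ceil_lt_add_one (by positivity)
    have h2 : |s| / (2 * Real.pi) ≤ |s| := div_le_self hs0.le (by linarith [Real.pi_gt_three])
    linarith
  have h1 : ∫ v in (0 : ℝ)..|s|, cosKernel c v ≤ m * cosKernelMass c := by
    have h2 := hper.intervalIntegral_add_zsmul_eq m 0
      (fun _ _ => hcont.intervalIntegrable _ _)
    simp only [zero_add, zsmul_eq_mul, Int.cast_natCast] at h2
    rw [cosKernelMass, ← h2]
    refine intervalIntegral.integral_mono_interval le_rfl hs0.le hm1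
      (Eventually.of_forall fun v => cosKernel_nonneg hc v) (hcont.intervalIntegrable _ _)
  rw [← intervalIntegral.integral_of_le zero_le_one]
  simp_rw [habs]
  rw [intervalIntegral.integral_comp_mul_right _ hs0.ne', zero_mul, one_mul, smul_eq_mul,
    inv_mul_le_iff₀ hs0]
  calc _ ≤ m * cosKernelMass c := h1
    _ ≤ 2 * |s| * cosKernelMass c := by
      gcongr
      exact cosKernelMass_nonneg hc
    _ = _ := by ring

/-- The kernel tends to `0` off the null set of multiples of `2π`. -/
lemma tendsto_cosKernelMass : Tendsto cosKernelMass atTop (𝓝 0) := by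
  have h0 : (0 : ℝ) = ∫ v in (0 : ℝ)..(2 * Real.pi), (0 : ℝ) := by simp
  have h1 : Tendsto (fun c => ∫ v in (0 : ℝ)..(2 * Real.pi), cosKernel c v) atTop
      (𝓝 (∫ v in (0 : ℝ)..(2 * Real.pi), (0 : ℝ))) := by
    refine intervalIntegral.tendsto_integral_filter_of_dominated_convergence (fun _ => 1) ?_ ?_
      intervalIntegrable_const ?_
    · filter_upwards [eventually_ge_atTop 0] with c hc
      exact (continuous_cosKernel hc).aestronglyMeasurable
    · filter_upwards [eventually_ge_atTop 0] with c hc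
      refine Eventually.of_forall fun v _ => ?_
      rw [Real.norm_of_nonneg (cosKernel_nonneg hc v)]
      exact cosKernel_le_one hc v
    · have hcount : (range fun n : ℤ => (n : ℝ) * (2 * Real.pi)).Countable := countable_range _
      filter_upwards [hcount.ae_notMem volume] with v hv _
      have hcos : Real.cos v < 1 := lt_of_le_of_ne (Real.cos_le_one v) fun h => hv (by
        obtain ⟨n, hn⟩ := (Real.cos_eq_one_iff v).1 h
        exact ⟨n, hn⟩)
      refine tendsto_const_nhds.div_atTop (tendsto_atTop_add_const_left _ _ ?_)
      exact tendsto_id.atTop_mul_const (sub_pos.2 hcos)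
  rw [← h0] at h1
  exact h1

/-- Jensen's inequality for the convex function `φ ↦ 1/(1 + φ)` under `m` normalised, applied to `φ
= c(1 - cos(uz))`, whose mean is `A`. -/
lemma one_div_one_add_integral_le {m : Measure ℝ} [IsFiniteMeasure m] (hm : 0 < m.real univ)
    (u : ℝ) :
    1 / (1 + ∫ z, (1 - Real.cos (u * z)) ∂m) ≤
      (m.real univ)⁻¹ * ∫ z, cosKernel (m.real univ) (u * z) ∂m := by
  set c := m.real univ with hc
  set A := ∫ z, (1 - Real.cos (u * z)) ∂m with hA
  have hi1 : Integrable (fun z => 1 - Real.cos (u * z)) m := by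
    refine Integrable.of_bound (C := 2) (by fun_prop) (Eventually.of_forall fun z => ?_)
    rw [Real.norm_eq_abs, abs_le]
    constructor <;> linarith [Real.cos_le_one (u * z), Real.neg_one_le_cos (u * z)]
  have hi2 : Integrable (fun z => cosKernel c (u * z)) m := by
    refine Integrable.of_bound (C := 1)
      ((continuous_cosKernel hm.le).comp (by fun_prop)).aestronglyMeasurable
      (Eventually.of_forall fun z => ?_)
    rw [Real.norm_of_nonneg (cosKernel_nonneg hm.le _)]
    exact cosKernel_le_one hm.le _
  have hA0 : 0 ≤ A := integral_nonneg fun z => sub_nonneg.2 (Real.cos_le_one _)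
  -- The tangent line at `A`; the gap is `(φ - A)² / ((1 + φ)(1 + A)²)`, and the linear term
  -- integrates to `0`.
  have hpt : ∀ z, 1 / (1 + A) - (c * (1 - Real.cos (u * z)) - A) / (1 + A) ^ 2 ≤
      cosKernel c (u * z) := by
    intro z
    have h1 := one_le_cosKernel_denom hm.le (u * z)
    rw [cosKernel]
    set φ := c * (1 - Real.cos (u * z))
    rw [← sub_nonneg]
    have : 1 / (1 + φ) - (1 / (1 + A) - (φ - A) / (1 + A) ^ 2) =
        (φ - A) ^ 2 / ((1 + φ) * (1 + A) ^ 2) := by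
      have h3 : 1 + φ ≠ 0 := by positivity
      have h4 : 1 + A ≠ 0 := by positivity
      field_simp
      ring
    rw [this]
    positivity
  have hi3 : Integrable (fun z => (c * (1 - Real.cos (u * z)) - A) / (1 + A) ^ 2) m :=
    ((hi1.const_mul c).sub (integrable_const A)).div_const _
  have h : ∫ z, (1 / (1 + A) - (c * (1 - Real.cos (u * z)) - A) / (1 + A) ^ 2) ∂m ≤
      ∫ z, cosKernel c (u * z) ∂m :=
    integral_mono ((integrable_const (1 / (1 + A))).sub hi3) hi2 hpt
  have h2 : ∫ z, (1 / (1 + A) - (c * (1 - Real.cos (u * z)) - A) / (1 + A) ^ 2) ∂m =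
      c * (1 / (1 + A)) := by
    rw [integral_sub (integrable_const _) hi3, integral_const, integral_div,
      integral_sub (hi1.const_mul c) (integrable_const A), integral_const_mul,
      integral_const, ← hc, ← hA, smul_eq_mul, smul_eq_mul, sub_self, zero_div,
      sub_zero]
  rw [h2] at h
  rwa [le_inv_mul_iff₀ hm]

/-- Jensen moves the integral in `z` outside the reciprocal, and Fubini then averages in `a` for
each fixed `z`. Since jumps are at least `δ`, frequencies `n ≥ 1/δ` give `|nz| ≥ 1`, as the bound
over periods requires. -/
lemma measureReal_singleton_le_cosKernelMass {μ m : Measure ℝ} [IsFiniteMeasure μ]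
    [IsFiniteMeasure m] (hm : 0 < m.real univ) {δ : ℝ} (hδ : 0 < δ) (hmδ : ∀ᵐ z ∂m, δ ≤ |z|)
    (h : ∀ u, ‖charFun μ u‖ ≤ 1 / (1 + ∫ z, (1 - Real.cos (u * z)) ∂m)) (y : ℝ) :
    μ.real {y} ≤ 2 * cosKernelMass (m.real univ) := by
  set c := m.real univ with hc
  have hcont := continuous_cosKernel hm.le
  refine measureReal_singleton_le_of_average_charFun ?_ y
  filter_upwards [eventually_ge_atTop ⌈1 / δ⌉₊] with n hn
  have hn' : 1 ≤ n * δ := (div_le_iff₀ hδ).1 (Nat.ceil_le.1 hn)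
  have hint : Integrable (Function.uncurry fun a z : ℝ => cosKernel c (n * a * z))
      ((volume.restrict (Ioc (0 : ℝ) 1)).prod m) := by
    refine Integrable.of_bound (C := 1)
      (hcont.comp (by fun_prop : Continuous fun p : ℝ × ℝ => n * p.1 * p.2)).aestronglyMeasurable
      (Eventually.of_forall fun p => ?_)
    rw [Function.uncurry, Real.norm_of_nonneg (cosKernel_nonneg hm.le _)]
    exact cosKernel_le_one hm.le _
  calc ∫ a in Ioc (0 : ℝ) 1, ‖charFun μ (n * a)‖
      ≤ ∫ a in Ioc (0 : ℝ) 1, c⁻¹ * ∫ z, cosKernel c (n * a * z) ∂m := by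
        refine integral_mono_of_nonneg (Eventually.of_forall fun a => norm_nonneg _)
          (hint.integral_prod_left.const_mul _) (Eventually.of_forall fun a => ?_)
        exact (h _).trans (one_div_one_add_integral_le hm _)
    _ = c⁻¹ * ∫ z, (∫ a in Ioc (0 : ℝ) 1, cosKernel c (n * a * z)) ∂m := by
        rw [integral_const_mul, integral_integral_swap hint]
    _ ≤ c⁻¹ * ∫ _, 2 * cosKernelMass c ∂m := by
        refine mul_le_mul_of_nonneg_left ?_ (inv_nonneg.2 hm.le)
        refine integral_mono_ae hint.integral_prod_right (integrable_const _) ?_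
        filter_upwards [hmδ] with z hz
        have h1 := average_cosKernel_le hm.le (s := n * z) (by
          rw [abs_mul, Nat.abs_cast]
          exact hn'.trans (by gcongr))
        refine le_trans (le_of_eq ?_) h1
        refine integral_congr_ae (Eventually.of_forall fun a => ?_)
        simp only
        ring_nf
    _ = 2 * cosKernelMass c := by
        rw [integral_const, smul_eq_mul, ← hc, inv_mul_cancel_left₀ hm.ne']

/-! ### A jointly measurable version of a càdlàg process -/

/-- The `n`-th approximation of `t` from the right. -/
def rightApprox (n : ℕ) (t : ℝ≥0) : ℝ≥0 := (⌊((n : ℝ≥0) + 1) * t⌋₊ + 1) / (n + 1)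

lemma lt_rightApprox (n : ℕ) (t : ℝ≥0) : t < rightApprox n t := by
  rw [rightApprox, lt_div_iff₀ (by positivity), mul_comm]
  exact Nat.lt_floor_add_one _

lemma rightApprox_le (n : ℕ) (t : ℝ≥0) : rightApprox n t ≤ t + 1 / (n + 1) := by
  have h : (t + 1 / ((n : ℝ≥0) + 1)) * (n + 1) = (n + 1) * t + 1 := by
    field_simp
  rw [rightApprox, div_le_iff₀ (by positivity), h]
  gcongr
  exact Nat.floor_le (by positivity)

lemma tendsto_rightApprox (t : ℝ≥0) :
    Tendsto (fun n => rightApprox n t) atTop (𝓝[≥] t) := by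
  refine tendsto_nhdsWithin_of_tendsto_nhds_of_eventually_within _ ?_
    (Eventually.of_forall fun n => (lt_rightApprox n t).le)
  refine tendsto_of_tendsto_of_tendsto_of_le_of_le tendsto_const_nhds ?_
    (fun n => (lt_rightApprox n t).le) (fun n => rightApprox_le n t)
  have : Tendsto (fun n : ℕ => 1 / ((n : ℝ≥0) + 1)) atTop (𝓝 0) :=
    tendsto_one_div_add_atTop_nhds_zero_nat
  simpa using this.const_add t

/-- A functional of paths that is jointly measurable in the path and the time, and that evaluates
right-continuous paths. -/
def evalRight (x : ℝ≥0 → ℝ) (t : ℝ≥0) : ℝ := limsup (fun n => x (rightApprox n t)) atTop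

lemma evalRight_eq {x : ℝ≥0 → ℝ} {t : ℝ≥0} (h : ContinuousWithinAt x (Ici t) t) :
    evalRight x t = x t :=
  (Tendsto.comp h (tendsto_rightApprox t)).limsup_eq

/-- Each approximation reads the path only on the countable grid of multiples of `1/(n + 1)`, so it
is jointly measurable on the full product space. -/
lemma measurable_evalRight : Measurable fun p : (ℝ≥0 → ℝ) × ℝ≥0 => evalRight p.1 p.2 := by
  refine Measurable.limsup fun n => ?_
  have h1 : Measurable fun p : (ℝ≥0 → ℝ) × ℕ => p.1 (((p.2 : ℝ≥0) + 1) / (n + 1)) :=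
    measurable_from_prod_countable_left fun k =>
      measurable_pi_apply (((k : ℝ≥0) + 1) / (n + 1))
  have h2 : Measurable fun p : (ℝ≥0 → ℝ) × ℝ≥0 => (p.1, ⌊((n : ℝ≥0) + 1) * p.2⌋₊) :=
    measurable_fst.prodMk (Nat.measurable_floor.comp (by fun_prop))
  exact h1.comp h2

attribute [irreducible] evalRight

section Levy

variable {Ω : Type*} [MeasurableSpace Ω] {P : Measure Ω} {X : ℝ≥0 → Ω → ℝ}

lemma IsLevyProcess.ae_evalRight_eq (hX : IsLevyProcess X P) :
    ∀ᵐ ω ∂P, ∀ t, evalRight (fun s => X s ω) t = X t ω := by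
  filter_upwards [hX.cadlag] with ω hω t
  exact evalRight_eq (hω t).1

lemma IsLevyProcess.measurable_path (hX : IsLevyProcess X P) :
    Measurable fun ω => fun t => X t ω :=
  measurable_pi_lambda _ hX.measurable

lemma IsLevyProcess.measurable_evalRight_path (hX : IsLevyProcess X P) :
    Measurable fun p : Ω × ℝ => evalRight (fun s => X s p.1) p.2.toNNReal := by
  have h : Measurable fun p : Ω × ℝ => ((fun s => X s p.1 : ℝ≥0 → ℝ), p.2.toNNReal) :=
    (hX.measurable_path.comp measurable_fst).prodMk (measurable_real_toNNReal.comp measurable_snd)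
  exact measurable_evalRight.comp h

/-! ### The discounted time measure and the resolvent -/

/-- The measure `e^{-qt} dt` on `(0, ∞)`. -/
def discountMeasure (q : ℝ) : Measure ℝ :=
  (volume.restrict (Ioi 0)).withDensity fun t => ENNReal.ofReal (Real.exp (-(q * t)))

lemma measurable_discount (q : ℝ) : Measurable fun t : ℝ => ENNReal.ofReal (Real.exp (-(q * t))) := by
  fun_prop

lemma lintegral_discount {q : ℝ} (hq : 0 < q) {s : ℝ} :
    ∫⁻ t in Ioi s, ENNReal.ofReal (Real.exp (-(q * t))) =
      ENNReal.ofReal (Real.exp (-(q * s)) / q) := by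
  rw [← ofReal_integral_eq_lintegral_ofReal]
  · have := integral_exp_mul_Ioi (a := -q) (by linarith) s
    simp only [neg_mul] at this
    rw [this]
    congr 1
    field_simp
  · have := integrableOn_exp_mul_Ioi (a := -q) (by linarith) s
    simp only [neg_mul] at this
    exact this
  · exact Eventually.of_forall fun t => (Real.exp_pos _).le

lemma discountMeasure_univ {q : ℝ} (hq : 0 < q) :
    discountMeasure q univ = ENNReal.ofReal (1 / q) := by
  rw [discountMeasure, withDensity_apply _ MeasurableSet.univ, Measure.restrict_univ,
    lintegral_discount hq]
  simp

lemma isFiniteMeasure_discountMeasure {q : ℝ} (hq : 0 < q) :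
    IsFiniteMeasure (discountMeasure q) :=
  ⟨by rw [discountMeasure_univ hq]; exact ENNReal.ofReal_lt_top⟩

lemma restrict_absolutelyContinuous_discountMeasure (q : ℝ) :
    volume.restrict (Ioi (0 : ℝ)) ≪ discountMeasure q :=
  withDensity_absolutelyContinuous' (measurable_discount q).aemeasurable
    (Eventually.of_forall fun t => by simp [Real.exp_pos])

/-- The law of the process at an independent exponential time of parameter one. -/
def resolventMeasure (X : ℝ≥0 → Ω → ℝ) (P : Measure Ω) : Measure ℝ :=
  (P.prod (discountMeasure 1)).map fun p => evalRight (fun s => X s p.1) p.2.toNNReal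

variable {γ σ : ℝ} {ν : Measure ℝ}

/-- A characteristic function has modulus at most `1`; take `t = 1`. -/
lemma re_levyExponent_nonneg [IsProbabilityMeasure P] (hX : ∀ t, Measurable (X t))
    (hν : HasLevyTriplet X P γ σ ν) (u : ℝ) : 0 ≤ (levyExponent γ σ ν u).re := by
  have : IsProbabilityMeasure (P.map (X 1)) := Measure.isProbabilityMeasure_map (hX 1).aemeasurable
  have h := norm_charFun_le_one (μ := P.map (X 1)) u
  rw [hν.charFun_eq, Complex.norm_exp] at h
  simpa using h

/-- Integrating over `ω` first leaves the integral of `e^{-t(1 + Ψ(u))}` over `t > 0`, which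
converges because `Re Ψ ≥ 0`. -/
lemma charFun_resolventMeasure [IsProbabilityMeasure P] (hX : IsLevyProcess X P)
    (hν : HasLevyTriplet X P γ σ ν) (u : ℝ) :
    charFun (resolventMeasure X P) u = 1 / (1 + levyExponent γ σ ν u) := by
  have := isFiniteMeasure_discountMeasure one_pos
  have hre := re_levyExponent_nonneg hX.measurable hν u
  have hmeas := hX.measurable_evalRight_path
  have hint : Integrable (fun p : Ω × ℝ => Complex.exp
      (u * (evalRight (fun s => X s p.1) p.2.toNNReal : ℝ) * Complex.I))
      (P.prod (discountMeasure 1)) := by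
    refine Integrable.of_bound (C := 1) ?_ (Eventually.of_forall fun p => ?_)
    · exact Measurable.aestronglyMeasurable (by fun_prop)
    · rw [← Complex.ofReal_mul, Complex.norm_exp_ofReal_mul_I]
  rw [charFun_apply_real, resolventMeasure, integral_map hmeas.aemeasurable
    (Measurable.aestronglyMeasurable (by fun_prop)), integral_prod_symm _ hint]
  have hinner : ∀ t : ℝ, ∫ ω, Complex.exp
      (u * (evalRight (fun s => X s ω) t.toNNReal : ℝ) * Complex.I) ∂P =
      Complex.exp (-((t.toNNReal : ℝ) : ℂ) * levyExponent γ σ ν u) := by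
    intro t
    rw [← hν.charFun_eq, charFun_apply_real, integral_map (hX.measurable _).aemeasurable
      (Measurable.aestronglyMeasurable (by fun_prop))]
    refine integral_congr_ae ?_
    filter_upwards [hX.ae_evalRight_eq] with ω hω
    rw [hω]
  simp only [hinner]
  rw [discountMeasure, integral_withDensity_eq_integral_toReal_smul (measurable_discount 1)
    (Eventually.of_forall fun _ => ENNReal.ofReal_lt_top)]
  have h1 := integral_exp_mul_complex_Ioi (a := -(1 + levyExponent γ σ ν u))
    (by simp only [Complex.neg_re, Complex.add_re, Complex.one_re]; linarith) 0
  rw [Complex.ofReal_zero, mul_zero, Complex.exp_zero, neg_div_neg_eq] at h1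
  rw [← h1]
  refine setIntegral_congr_fun measurableSet_Ioi fun t ht => ?_
  rw [ENNReal.toReal_ofReal (Real.exp_pos _).le, Real.coe_toNNReal _ (le_of_lt ht), one_mul,
    Complex.real_smul, Complex.ofReal_exp, ← Complex.exp_add]
  push_cast
  ring_nf

/-! ### The real part of the Lévy exponent -/

/-- For real `u` the exponential has modulus `1`, so no exponential moment is needed: Taylor
expansion for small jumps, a constant bound for large ones. -/
lemma norm_levyIntegrand_le (u z : ℝ) :
    ‖levyIntegrand u z‖ ≤ (3 * u ^ 2 + 2) * min 1 (z ^ 2) := by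
  have hIm : Complex.I * u * z = Complex.I * ((u * z : ℝ) : ℂ) := by push_cast; ring
  have hexp : ‖Complex.exp (Complex.I * ((u * z : ℝ) : ℂ))‖ = 1 := Complex.norm_exp_I_mul_ofReal _
  have hn : ‖Complex.I * ((u * z : ℝ) : ℂ)‖ = |u * z| := by
    rw [norm_mul, Complex.norm_I, one_mul, Complex.norm_real, Real.norm_eq_abs]
  rcases lt_or_ge |z| 1 with hz | hz
  · have h1 : min 1 (z ^ 2) = z ^ 2 :=
      min_eq_right (by rw [← sq_abs]; nlinarith [abs_nonneg z])
    rw [levyIntegrand, indicator_of_mem (show z ∈ {y : ℝ | |y| < 1} from hz), mul_one, h1, hIm]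
    have h2 : ‖1 - Complex.exp (Complex.I * ((u * z : ℝ) : ℂ)) + Complex.I * ((u * z : ℝ) : ℂ)‖ ≤
        3 * |u * z| ^ 2 := by
      rcases le_or_gt |u * z| 1 with h | h
      · have h3 := Complex.norm_exp_sub_one_sub_id_le (x := Complex.I * ((u * z : ℝ) : ℂ))
          (hn.trans_le h)
        rw [hn] at h3
        rw [← norm_neg]
        refine le_trans (le_of_eq ?_) (h3.trans (by nlinarith [sq_nonneg |u * z|]))
        congr 1
        ring
      · refine (norm_add_le _ _).trans ?_
        have h3 := norm_sub_le (1 : ℂ) (Complex.exp (Complex.I * ((u * z : ℝ) : ℂ)))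
        rw [hexp, norm_one] at h3
        rw [hn]
        nlinarith
    rw [sq_abs, mul_pow] at h2
    nlinarith [sq_nonneg z]
  · have h1 : min 1 (z ^ 2) = 1 :=
      min_eq_left (by rw [← sq_abs]; nlinarith [abs_nonneg z])
    rw [levyIntegrand, indicator_of_notMem (show z ∉ {y : ℝ | |y| < 1} from not_lt.2 hz), mul_zero,
      add_zero, h1, hIm]
    have h3 := norm_sub_le (1 : ℂ) (Complex.exp (Complex.I * ((u * z : ℝ) : ℂ)))
    rw [hexp, norm_one] at h3
    nlinarith [sq_nonneg u]

lemma integrable_levyIntegrand (hν : IsLevyMeasure ν) (u : ℝ) :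
    Integrable (levyIntegrand u) ν :=
  ((integrable_min_one_sq hν).const_mul (3 * u ^ 2 + 2)).mono'
    (measurable_levyIntegrand u).aestronglyMeasurable
    (Eventually.of_forall fun z => norm_levyIntegrand_le u z)

lemma re_levyIntegrand (u z : ℝ) : (levyIntegrand u z).re = 1 - Real.cos (u * z) := by
  have hIm : Complex.I * u * z = ((u * z : ℝ) : ℂ) * Complex.I := by push_cast; ring
  rw [levyIntegrand, hIm, Complex.add_re, Complex.sub_re, Complex.exp_ofReal_mul_I_re,
    Complex.one_re]
  by_cases hz : z ∈ {y : ℝ | |y| < 1}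
  · simp [indicator_of_mem hz]
  · simp [indicator_of_notMem hz]

lemma integrable_one_sub_cos (hν : IsLevyMeasure ν) (u : ℝ) :
    Integrable (fun z => 1 - Real.cos (u * z)) ν := by
  refine (integrable_levyIntegrand hν u).re.congr (Eventually.of_forall fun z => ?_)
  simp [re_levyIntegrand]

lemma re_levyExponent (hν : IsLevyMeasure ν) (u : ℝ) :
    (levyExponent γ σ ν u).re = σ ^ 2 * u ^ 2 / 2 + ∫ z, (1 - Real.cos (u * z)) ∂ν := by
  have h1 : (∫ z, levyIntegrand u z ∂ν).re = ∫ z, (1 - Real.cos (u * z)) ∂ν := by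
    have := integral_re (integrable_levyIntegrand hν u)
    simp only [RCLike.re_to_complex, re_levyIntegrand] at this
    exact this.symm
  rw [levyExponent_eq, complexExponent, Complex.add_re, h1]
  congr 1
  have : -(Complex.I * γ * u) + (1 / 2 : ℂ) * (σ : ℂ) ^ 2 * (u : ℂ) ^ 2 =
      ((σ ^ 2 * u ^ 2 / 2 : ℝ) : ℂ) + ((-(γ * u) : ℝ) : ℂ) * Complex.I := by
    push_cast; ring
  rw [this, Complex.add_re, Complex.ofReal_re, Complex.re_ofReal_mul, Complex.I_re, mul_zero,
    add_zero]

lemma norm_one_div_one_add_le {z : ℂ} {r : ℝ} (hr : 0 ≤ r) (hz : r ≤ z.re) :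
    ‖1 / (1 + z)‖ ≤ 1 / (1 + r) := by
  rw [norm_div, norm_one]
  refine one_div_le_one_div_of_le (by linarith) ?_
  have := Complex.re_le_norm (1 + z)
  simp only [Complex.add_re, Complex.one_re] at this
  linarith

/-! ### Compound Poisson laws -/

lemma isProbabilityMeasure_iterate_conv (F : Measure ℝ) [IsProbabilityMeasure F] (n : ℕ) :
    IsProbabilityMeasure ((fun μ => F.conv μ)^[n] (Measure.dirac 0)) := by
  induction n with
  | zero => rw [Function.iterate_zero, id]; infer_instance
  | succ n ih => rw [Function.iterate_succ_apply']; infer_instance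

lemma charFun_iterate_conv (F : Measure ℝ) [IsProbabilityMeasure F] (n : ℕ) (u : ℝ) :
    charFun ((fun μ => F.conv μ)^[n] (Measure.dirac 0)) u = charFun F u ^ n := by
  induction n with
  | zero => simp [charFun_dirac]
  | succ n ih =>
    have := isProbabilityMeasure_iterate_conv F n
    rw [Function.iterate_succ_apply', charFun_conv, ih, pow_succ']

lemma isProbabilityMeasure_compoundPoissonMeasure (r : ℝ≥0) (F : Measure ℝ)
    [IsProbabilityMeasure F] : IsProbabilityMeasure (compoundPoissonMeasure r F) := by
  refine ⟨?_⟩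
  rw [compoundPoissonMeasure, Measure.sum_apply _ MeasurableSet.univ]
  have h : ∀ n, (poissonMeasure r {n} • (fun μ => F.conv μ)^[n] (Measure.dirac 0)) univ =
      poissonMeasure r {n} := fun n => by
    have := isProbabilityMeasure_iterate_conv F n
    simp
  simp_rw [h]
  rw [← measure_iUnion (fun i j hij => by simpa using hij) (fun n => measurableSet_singleton n),
    iUnion_of_singleton, measure_univ]

lemma charFun_compoundPoissonMeasure (r : ℝ≥0) (F : Measure ℝ) [IsProbabilityMeasure F] (u : ℝ) :
    charFun (compoundPoissonMeasure r F) u = Complex.exp (r * (charFun F u - 1)) := by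
  have := isProbabilityMeasure_compoundPoissonMeasure r F
  have hint : Integrable (fun x : ℝ => Complex.exp (u * x * Complex.I))
      (compoundPoissonMeasure r F) := by
    refine Integrable.of_bound (C := 1) (by fun_prop) (Eventually.of_forall fun x => ?_)
    rw [← Complex.ofReal_mul, Complex.norm_exp_ofReal_mul_I]
  have h1 := hasSum_integral_measure hint
  have h2 : ∀ n : ℕ, ∫ x : ℝ, Complex.exp (u * x * Complex.I)
      ∂(poissonMeasure r {n} • (fun μ => F.conv μ)^[n] (Measure.dirac 0)) =
      Complex.exp (-r) * ((r * charFun F u) ^ n / n.factorial) := fun n => by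
    rw [integral_smul_measure, ← charFun_apply_real, charFun_iterate_conv,
      poissonMeasure_singleton, ENNReal.toReal_ofReal (by positivity), Complex.real_smul]
    push_cast
    ring
  simp_rw [h2] at h1
  have h3 := (NormedSpace.expSeries_div_hasSum_exp (r * charFun F u)).mul_left (Complex.exp (-r))
  rw [charFun_apply_real, compoundPoissonMeasure, h1.unique h3, ← Complex.exp_eq_exp_ℂ, ← Complex.exp_add]
  ring_nf

/-- A Lévy process without Gaussian part, with finite Lévy measure and without drift is a driftless
compound Poisson process. -/
lemma isDriftlessCompoundPoisson_of_levyExponent [IsProbabilityMeasure P]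
    (hX : ∀ t, Measurable (X t)) (hν : HasLevyTriplet X P γ σ ν) [IsFiniteMeasure ν]
    (h : ∀ u, levyExponent γ σ ν u = ∫ z, (1 - Complex.exp (u * z * Complex.I)) ∂ν) :
    IsDriftlessCompoundPoisson X P := by
  -- The jump law is the normalised Lévy measure and the rate is its mass. If the mass is `0`, any
  -- probability law serves.
  obtain ⟨F, hF, hFν⟩ : ∃ F : Measure ℝ, IsProbabilityMeasure F ∧
      ν = ν univ • F := by
    by_cases h0 : ν univ = 0
    · exact ⟨Measure.dirac 0, inferInstance, by simp [Measure.measure_univ_eq_zero.1 h0]⟩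
    · refine ⟨(ν univ)⁻¹ • ν, ⟨?_⟩, ?_⟩
      · rw [Measure.smul_apply, smul_eq_mul, ENNReal.inv_mul_cancel h0 (measure_ne_top _ _)]
      · rw [smul_smul, ENNReal.mul_inv_cancel h0 (measure_ne_top _ _), one_smul]
  refine ⟨(ν univ).toNNReal, F, hF, fun t => ?_⟩
  have := isProbabilityMeasure_compoundPoissonMeasure ((ν univ).toNNReal * t) F
  have : IsProbabilityMeasure (P.map (X t)) := Measure.isProbabilityMeasure_map (hX t).aemeasurable
  refine Measure.ext_of_charFun (funext fun u => ?_)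
  have hint : Integrable (fun x : ℝ => Complex.exp (u * x * Complex.I)) ν := by
    refine Integrable.of_bound (C := 1) (by fun_prop) (Eventually.of_forall fun x => ?_)
    rw [← Complex.ofReal_mul, Complex.norm_exp_ofReal_mul_I]
  have h1 : ∫ x : ℝ, Complex.exp (u * x * Complex.I) ∂ν = ν.real univ * charFun F u := by
    conv_lhs => rw [hFν]
    rw [integral_smul_measure, charFun_apply_real, Complex.real_smul, measureReal_def]
  rw [hν.charFun_eq, charFun_compoundPoissonMeasure, h, integral_sub (integrable_const _) hint, h1,
    integral_const]
  congr 1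
  simp only [NNReal.coe_mul, Complex.ofReal_mul, ENNReal.coe_toNNReal_eq_toReal, measureReal_def,
    Complex.real_smul, mul_one]
  ring

/-! ### The resolvent has no atoms -/

/-- The Gaussian part alone makes `Re Ψ(u) ≥ σ²u²/2`, so `1/(1 + Ψ)` vanishes at infinity. -/
lemma measureReal_resolventMeasure_singleton_of_sigma [IsProbabilityMeasure P]
    [IsFiniteMeasure (resolventMeasure X P)] (hX : IsLevyProcess X P)
    (hν : HasLevyTriplet X P γ σ ν) (hσ : σ ≠ 0) (y : ℝ) :
    (resolventMeasure X P).real {y} = 0 := by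
  refine measureReal_singleton_eq_zero_of_tendsto ?_ y
  have hlim : Tendsto (fun u : ℝ => 1 / (1 + σ ^ 2 / 2 * u ^ 2)) atTop (𝓝 0) := by
    refine tendsto_const_nhds.div_atTop (tendsto_atTop_add_const_left _ _ ?_)
    exact (tendsto_pow_atTop two_ne_zero).const_mul_atTop (by positivity)
  refine squeeze_zero (fun u => norm_nonneg _) (fun u => ?_) hlim
  rw [charFun_resolventMeasure hX hν]
  refine norm_one_div_one_add_le (by positivity) ?_
  rw [re_levyExponent hν.isLevyMeasure]
  have : 0 ≤ ∫ z, (1 - Real.cos (u * z)) ∂ν :=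
    integral_nonneg fun z => sub_nonneg.2 (Real.cos_le_one _)
  linarith

/-- With finite `ν` the compensator can be absorbed: `Ψ` is a bounded term plus `-iu(γ - D)`, where
`γ - D` is the true drift. Zero drift is the excluded compound Poisson case; otherwise `|Ψ|` grows
linearly. -/
lemma measureReal_resolventMeasure_singleton_of_finite [IsProbabilityMeasure P]
    [IsFiniteMeasure (resolventMeasure X P)] (hX : IsLevyProcess X P)
    (hν : HasLevyTriplet X P γ σ ν) (hσ : σ = 0) [IsFiniteMeasure ν]
    (hcpp : ¬ IsDriftlessCompoundPoisson X P) (y : ℝ) :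
    (resolventMeasure X P).real {y} = 0 := by
  set I₁ : ℝ → ℂ := indicator {y : ℝ | |y| < 1} (fun _ => (1 : ℂ)) with hI₁
  have hI₁m : Measurable I₁ := measurable_const.indicator measurableSet_abs_lt_one
  set D : ℂ := ∫ z : ℝ, (z : ℂ) * I₁ z ∂ν with hD
  have hi1 : ∀ u : ℝ, Integrable (fun z : ℝ => 1 - Complex.exp (u * z * Complex.I)) ν := by
    intro u
    refine Integrable.of_bound (C := 2) (by fun_prop) (Eventually.of_forall fun x => ?_)
    refine (norm_sub_le _ _).trans ?_
    rw [← Complex.ofReal_mul, Complex.norm_exp_ofReal_mul_I, norm_one]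
    norm_num
  have hi2 : Integrable (fun z : ℝ => (z : ℂ) * I₁ z) ν := by
    refine Integrable.of_bound (C := 1) (Measurable.aestronglyMeasurable (by fun_prop))
      (Eventually.of_forall fun z => ?_)
    by_cases hz : z ∈ {y : ℝ | |y| < 1}
    · rw [hI₁, indicator_of_mem hz, mul_one, Complex.norm_real]
      exact (show |z| < 1 from hz).le
    · rw [hI₁, indicator_of_notMem hz]; simp
  have hΨ : ∀ u : ℝ, levyExponent γ σ ν u =
      -(u * (γ - D)) * Complex.I + ∫ z : ℝ, (1 - Complex.exp (u * z * Complex.I)) ∂ν := by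
    intro u
    have h1 : ∫ z, levyIntegrand u z ∂ν =
        ∫ z : ℝ, (1 - Complex.exp (u * z * Complex.I)) ∂ν + (Complex.I * u) * D := by
      rw [hD, ← integral_const_mul, ← integral_add (hi1 u) (hi2.const_mul _)]
      refine integral_congr_ae (Eventually.of_forall fun z => ?_)
      simp only [levyIntegrand, hI₁]
      ring_nf
    rw [levyExponent_eq, complexExponent, h1, hσ]
    push_cast
    ring
  by_cases hd : (γ : ℂ) - D = 0
  · exact absurd (isDriftlessCompoundPoisson_of_levyExponent hX.measurable hν fun u => by
      rw [hΨ, hd]; simp) hcpp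
  · refine measureReal_singleton_eq_zero_of_tendsto ?_ y
    have hlim : Tendsto (fun u : ℝ => 1 / (u * ‖(γ : ℂ) - D‖ - (1 + 2 * ν.real univ))) atTop
        (𝓝 0) := by
      refine tendsto_const_nhds.div_atTop ?_
      exact tendsto_atTop_add_const_right _ _ (tendsto_id.atTop_mul_const (norm_pos_iff.2 hd))
    refine squeeze_zero' (Eventually.of_forall fun u => norm_nonneg _) ?_ hlim
    filter_upwards [eventually_gt_atTop ((1 + 2 * ν.real univ) / ‖(γ : ℂ) - D‖),
      eventually_ge_atTop 0] with u hu hu0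
    rw [div_lt_iff₀ (norm_pos_iff.2 hd)] at hu
    rw [charFun_resolventMeasure hX hν, norm_div, norm_one]
    refine one_div_le_one_div_of_le (by linarith) ?_
    have hJ : ‖∫ z : ℝ, (1 - Complex.exp (u * z * Complex.I)) ∂ν‖ ≤ 2 * ν.real univ := by
      refine norm_integral_le_of_norm_le_const (Eventually.of_forall fun x => ?_)
      refine (norm_sub_le _ _).trans ?_
      rw [← Complex.ofReal_mul, Complex.norm_exp_ofReal_mul_I, norm_one]
      norm_num
    set J := ∫ z : ℝ, (1 - Complex.exp (u * z * Complex.I)) ∂ν with hJdef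
    have h1 : ‖(u : ℂ) * (γ - D) * Complex.I‖ = u * ‖(γ : ℂ) - D‖ := by
      rw [norm_mul, norm_mul, Complex.norm_I, mul_one, Complex.norm_real, Real.norm_of_nonneg hu0]
    rw [hΨ, ← hJdef]
    have h2 : (u : ℂ) * (γ - D) * Complex.I =
        1 + J - (1 + (-(u * (γ - D)) * Complex.I + J)) := by ring
    have h3 := norm_sub_le (1 + J) (1 + (-(u * (γ - D)) * Complex.I + J))
    rw [← h2, h1] at h3
    have h4 := norm_add_le (1 : ℂ) J
    rw [norm_one] at h4
    linarith

lemma levyMeasure_compl_ball_lt_top (hν : IsLevyMeasure ν) {δ : ℝ} (hδ : 0 < δ) :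
    ν {z : ℝ | δ ≤ |z|} < ∞ := by
  have hc : ENNReal.ofReal (min 1 (δ ^ 2)) ≠ 0 := by
    rw [Ne, ENNReal.ofReal_eq_zero, not_le]
    positivity
  refine lt_of_le_of_lt (measure_mono fun z (hz : δ ≤ |z|) => ?_)
    ((meas_ge_le_lintegral_div (f := fun z : ℝ => ENNReal.ofReal (min 1 (z ^ 2))) (by fun_prop)
      hc ENNReal.ofReal_ne_top).trans_lt (ENNReal.div_lt_top hν.lintegral_lt_top.ne hc))
  refine ENNReal.ofReal_le_ofReal (min_le_min le_rfl ?_)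
  rw [← sq_abs z]
  gcongr

/-- `Re Ψ` need not tend to infinity here, so averages are used. Discarding the Gaussian part and
the jumps below `1/(n + 1)` only lowers `Re Ψ`, and the mass of the remaining jumps is finite but
tends to infinity with `n`. -/
lemma measureReal_resolventMeasure_singleton_of_infinite [IsProbabilityMeasure P]
    [IsFiniteMeasure (resolventMeasure X P)] (hX : IsLevyProcess X P)
    (hν : HasLevyTriplet X P γ σ ν) (hinf : ν univ = ∞) (y : ℝ) :
    (resolventMeasure X P).real {y} = 0 := by
  set δ : ℕ → ℝ := fun n => 1 / ((n : ℝ) + 1) with hδ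
  have hδ0 : ∀ n, 0 < δ n := fun n => by positivity
  set S : ℕ → Set ℝ := fun n => {z : ℝ | δ n ≤ |z|} with hS
  have hSm : ∀ n, MeasurableSet (S n) := fun n => measurableSet_le (by fun_prop) (by fun_prop)
  have hfin : ∀ n, ν (S n) < ∞ := fun n => levyMeasure_compl_ball_lt_top hν.isLevyMeasure (hδ0 n)
  have hmono : Monotone S := by
    intro m n hmn z (hz : δ m ≤ |z|)
    exact (one_div_le_one_div_of_le (by positivity) (by gcongr)).trans hz
  have hunion : ⋃ n, S n = {0}ᶜ := by
    ext z
    simp only [mem_iUnion, mem_compl_iff, mem_singleton_iff]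
    constructor
    · rintro ⟨n, hn⟩ rfl
      have : δ n ≤ |(0 : ℝ)| := hn
      rw [abs_zero] at this
      exact absurd this (not_le.2 (hδ0 n))
    · intro hz
      obtain ⟨n, hn⟩ := exists_nat_one_div_lt (abs_pos.2 hz)
      exact ⟨n, hn.le⟩
  have hlim : Tendsto (fun n => ν (S n)) atTop (𝓝 ∞) := by
    have h1 := tendsto_measure_iUnion_atTop (μ := ν) hmono
    rw [hunion] at h1
    have h2 : ν {0}ᶜ = ∞ := by
      have h3 := measure_univ_le_add_compl (μ := ν) {0}
      rw [hν.isLevyMeasure.zero, zero_add, hinf] at h3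
      exact top_le_iff.1 h3
    rwa [h2] at h1
  have hlim' : Tendsto (fun n => (ν (S n)).toReal) atTop atTop := by
    refine tendsto_atTop.2 fun b => ?_
    filter_upwards [(tendsto_order.1 hlim).1 (ENNReal.ofReal b) ENNReal.ofReal_lt_top] with n hn
    exact (ENNReal.ofReal_le_iff_le_toReal (hfin n).ne).1 hn.le
  have hbound : ∀ᶠ n in atTop, (resolventMeasure X P).real {y} ≤
      2 * cosKernelMass (ν (S n)).toReal := by
    filter_upwards [hlim'.eventually_gt_atTop 0] with n hn
    have : IsFiniteMeasure (ν.restrict (S n)) := ⟨by simpa using hfin n⟩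
    have hmass : (ν.restrict (S n)).real univ = (ν (S n)).toReal := by simp [measureReal_def]
    rw [← hmass]
    refine measureReal_singleton_le_cosKernelMass (m := ν.restrict (S n)) (by rwa [hmass]) (hδ0 n)
      (ae_restrict_mem (hSm n)) (fun u => ?_) y
    rw [charFun_resolventMeasure hX hν]
    refine norm_one_div_one_add_le
      (integral_nonneg fun z => sub_nonneg.2 (Real.cos_le_one _)) ?_
    rw [re_levyExponent hν.isLevyMeasure]
    have h1 := setIntegral_le_integral (s := S n) (integrable_one_sub_cos hν.isLevyMeasure u)
      (Eventually.of_forall fun z => sub_nonneg.2 (Real.cos_le_one _))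
    have h2 : 0 ≤ σ ^ 2 * u ^ 2 / 2 := by positivity
    linarith
  refine le_antisymm ?_ measureReal_nonneg
  have := (tendsto_cosKernelMass.comp hlim').const_mul 2
  rw [mul_zero] at this
  exact ge_of_tendsto this hbound

/-- Unless it is a driftless compound Poisson process, a Lévy process spends no time at a given
point. -/
lemma measure_evalRight_eq_zero [IsProbabilityMeasure P] (hX : IsLevyProcess X P)
    (hν : HasLevyTriplet X P γ σ ν) (hcpp : ¬ IsDriftlessCompoundPoisson X P) (y : ℝ) :
    (P.prod (volume.restrict (Ioi 0)))
      {p : Ω × ℝ | evalRight (fun s => X s p.1) p.2.toNNReal = y} = 0 := by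
  have := isFiniteMeasure_discountMeasure one_pos
  have hfin : IsFiniteMeasure (resolventMeasure X P) := by
    unfold resolventMeasure; infer_instance
  have h0 : (resolventMeasure X P).real {y} = 0 := by
    by_cases hσ : σ = 0
    · by_cases hinf : ν univ = ∞
      · exact measureReal_resolventMeasure_singleton_of_infinite hX hν hinf y
      · have : IsFiniteMeasure ν := ⟨lt_top_iff_ne_top.2 hinf⟩
        exact measureReal_resolventMeasure_singleton_of_finite hX hν hσ hcpp y
    · exact measureReal_resolventMeasure_singleton_of_sigma hX hν hσ y
  rw [measureReal_eq_zero_iff, resolventMeasure, Measure.map_apply hX.measurable_evalRight_path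
    (measurableSet_singleton y)] at h0
  exact Measure.AbsolutelyContinuous.prod Measure.AbsolutelyContinuous.rfl
    (restrict_absolutelyContinuous_discountMeasure 1) h0

end Levy

/-! ### Independence, arrival times and the state at an arrival -/

section Indep

variable {Ω : Type*} [MeasurableSpace Ω] {P : Measure Ω}

lemma lintegral_indepFun [IsProbabilityMeasure P] {α β : Type*} [MeasurableSpace α]
    [MeasurableSpace β] {A : Ω → α} {B : Ω → β} (hA : Measurable A) (hB : Measurable B)
    (h : IndepFun A B P) {Φ : α × β → ℝ≥0∞} (hΦ : Measurable Φ) :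
    ∫⁻ ω, Φ (A ω, B ω) ∂P = ∫⁻ ω', ∫⁻ ω, Φ (A ω, B ω') ∂P ∂P := by
  have : IsProbabilityMeasure (P.map A) := Measure.isProbabilityMeasure_map hA.aemeasurable
  have : IsProbabilityMeasure (P.map B) := Measure.isProbabilityMeasure_map hB.aemeasurable
  rw [← lintegral_map hΦ (hA.prodMk hB),
    (indepFun_iff_map_prod_eq_prod_map_map hA.aemeasurable hB.aemeasurable).1 h,
    lintegral_prod_symm' _ hΦ, lintegral_map hΦ.lintegral_prod_left' hB]
  refine lintegral_congr fun ω' => ?_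
  rw [lintegral_map (by fun_prop) hA]

/-! ### Poisson arrival times -/

variable {T : ℕ → Ω → ℝ≥0} {η : ℝ}

lemma expMeasure_Iic_zero (hη : 0 < η) : expMeasure η (Iic 0) = 0 := by
  have := isProbabilityMeasure_expMeasure hη
  have h := cdf_expMeasure_eq hη 0
  rw [cdf_eq_real] at h
  simpa [measureReal_eq_zero_iff] using h

lemma IsPoissonArrivals.ae_strictMono (hT : IsPoissonArrivals T η P) (hη : 0 < η) :
    ∀ᵐ ω ∂P, StrictMono fun k => T k ω := by
  have h : ∀ k, ∀ᵐ ω ∂P, T k ω < T (k + 1) ω := by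
    intro k
    have h1 : ∀ᵐ x ∂(expMeasure η), 0 < x := by
      rw [ae_iff]
      simpa [Iic] using expMeasure_Iic_zero hη
    rw [← (hT.law k).map_eq] at h1
    filter_upwards [ae_of_ae_map (hT.law k).aemeasurable h1] with ω hω
    exact_mod_cast sub_pos.1 hω
  filter_upwards [ae_all_iff.2 h] with ω hω
  exact strictMono_nat_of_lt_succ hω

lemma lintegral_exp_expMeasure_lt_one (hη : 0 < η) {a : ℝ} (ha : 0 < a) :
    ∫⁻ x, ENNReal.ofReal (Real.exp (-(a * x))) ∂(expMeasure η) < 1 := by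
  have := isProbabilityMeasure_expMeasure hη
  have h1 : ∀ᵐ x ∂(expMeasure η), ENNReal.ofReal (Real.exp (-(a * x))) < 1 := by
    have h : ∀ᵐ x ∂(expMeasure η), 0 < x := by
      rw [ae_iff]
      simpa [Iic] using expMeasure_Iic_zero hη
    filter_upwards [h] with x hx
    rw [← ENNReal.ofReal_one]
    refine (ENNReal.ofReal_lt_ofReal_iff one_pos).2 ?_
    simpa using mul_pos ha hx
  have h2 : ∫⁻ x, ENNReal.ofReal (Real.exp (-(a * x))) ∂(expMeasure η) ≤ 1 := by
    calc _ ≤ ∫⁻ _, 1 ∂(expMeasure η) := lintegral_mono_ae (h1.mono fun x hx => hx.le)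
      _ = 1 := by simp
  calc _ < ∫⁻ _, 1 ∂(expMeasure η) := lintegral_strict_mono (IsProbabilityMeasure.ne_zero _)
        aemeasurable_const (h2.trans_lt ENNReal.one_lt_top).ne h1
    _ = 1 := by simp

/-- `T k` is a sum of `k` i.i.d. interarrival times, so its Laplace transform is a `k`-th power. -/
lemma IsPoissonArrivals.lintegral_exp (hT : IsPoissonArrivals T η P) {a : ℝ} (k : ℕ) :
    ∫⁻ ω, ENNReal.ofReal (Real.exp (-(a * T k ω))) ∂P =
      (∫⁻ x, ENNReal.ofReal (Real.exp (-(a * x))) ∂(expMeasure η)) ^ k := by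
  have hprob := hT.indep.isProbabilityMeasure
  have hmeas : ∀ i, Measurable fun ω => (T (i + 1) ω : ℝ) - T i ω := fun i =>
    (hT.measurable _).coe_nnreal_real.sub (hT.measurable _).coe_nnreal_real
  have hexp : Measurable fun x : ℝ => ENNReal.ofReal (Real.exp (-(a * x))) := by fun_prop
  have h1 := lintegral_prod_eq_prod_lintegral_of_indepFun (Finset.range k)
    (fun i ω => ENNReal.ofReal (Real.exp (-(a * ((T (i + 1) ω : ℝ) - T i ω)))))
    (hT.indep.comp (fun _ => fun x : ℝ => ENNReal.ofReal (Real.exp (-(a * x)))) fun _ => hexp)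
    (fun i => hexp.comp (hmeas i))
  have h2 : ∀ ω, ∏ i ∈ Finset.range k,
      ENNReal.ofReal (Real.exp (-(a * ((T (i + 1) ω : ℝ) - T i ω)))) =
      ENNReal.ofReal (Real.exp (-(a * T k ω))) := by
    intro ω
    rw [← ENNReal.ofReal_prod_of_nonneg fun i _ => (Real.exp_pos _).le, ← Real.exp_sum,
      Finset.sum_neg_distrib, ← Finset.mul_sum, Finset.sum_range_sub (fun i => (T i ω : ℝ)),
      hT.zero, NNReal.coe_zero, sub_zero]
  simp_rw [h2] at h1
  rw [h1]
  have h3 : ∀ i, ∫⁻ ω, ENNReal.ofReal (Real.exp (-(a * ((T (i + 1) ω : ℝ) - T i ω)))) ∂P =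
      ∫⁻ x, ENNReal.ofReal (Real.exp (-(a * x))) ∂(expMeasure η) := by
    intro i
    rw [← (hT.law i).map_eq, lintegral_map hexp (hmeas i)]
  simp [h3]

lemma IsPoissonArrivals.tsum_lintegral_exp_lt_top (hT : IsPoissonArrivals T η P) (hη : 0 < η)
    {a : ℝ} (ha : 0 < a) :
    ∑' k, ∫⁻ ω, ENNReal.ofReal (Real.exp (-(a * T k ω))) ∂P < ∞ := by
  simp_rw [hT.lintegral_exp, ENNReal.tsum_geometric]
  rw [ENNReal.inv_lt_top, tsub_pos_iff_lt]
  exact lintegral_exp_expMeasure_lt_one hη ha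

/-- The sum of `e^{-T k}` has finite mean, hence is almost surely finite. Its terms tend to `0`, so
the arrivals are unbounded. -/
lemma IsPoissonArrivals.ae_exists_lt (hT : IsPoissonArrivals T η P) (hη : 0 < η) :
    ∀ᵐ ω ∂P, ∀ t : ℝ≥0, ∃ k, t < T k ω := by
  have hm : ∀ k, Measurable fun ω => ENNReal.ofReal (Real.exp (-(1 * (T k ω : ℝ)))) := fun k => by
    have := hT.measurable k
    fun_prop
  have h1 : ∫⁻ ω, ∑' k, ENNReal.ofReal (Real.exp (-(1 * (T k ω : ℝ)))) ∂P ≠ ∞ := by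
    rw [lintegral_tsum fun k => (hm k).aemeasurable]
    exact (hT.tsum_lintegral_exp_lt_top hη one_pos).ne
  filter_upwards [ae_lt_top' (Measurable.tsum hm).aemeasurable h1] with ω hω t
  by_contra! hcon
  have h2 := ENNReal.tendsto_atTop_zero_of_tsum_ne_top hω.ne
  have h3 : ENNReal.ofReal (Real.exp (-(t : ℝ))) ≤ 0 := by
    refine ge_of_tendsto' h2 fun k => ENNReal.ofReal_le_ofReal (Real.exp_le_exp.2 ?_)
    exact neg_le_neg (by simpa using hcon k)
  rw [nonpos_iff_eq_zero, ENNReal.ofReal_eq_zero] at h3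
  exact absurd h3 (not_le.2 (Real.exp_pos _))

lemma exists_mem_Ico_of_exists_lt {τ : ℕ → ℝ≥0} (h0 : τ 0 = 0) {t : ℝ≥0} (h : ∃ k, t < τ k) :
    ∃ k, τ k ≤ t ∧ t < τ (k + 1) := by
  classical
  obtain ⟨k, hk⟩ : ∃ k, Nat.find h = k + 1 := by
    refine Nat.exists_eq_succ_of_ne_zero fun h1 => ?_
    have := Nat.find_spec h
    rw [h1, h0] at this
    simp at this
  refine ⟨k, not_lt.1 (Nat.find_min h (by omega)), ?_⟩
  rw [← hk]
  exact Nat.find_spec h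

/-! ### The controlled path has no atoms -/

lemma measurable_runningMax {α : Type*} [MeasurableSpace α] {x : α → ℝ≥0 → ℝ}
    {τ : α → ℕ → ℝ≥0} (h : ∀ k, Measurable fun a => x a (τ a (k + 1))) (k : ℕ) :
    Measurable fun a => runningMax (x a) (τ a) k := by
  induction k with
  | zero => exact measurable_const
  | succ k ih => exact ih.max (h k).neg

lemma runningMax_congr {x x' : ℝ≥0 → ℝ} {τ τ' : ℕ → ℝ≥0} {k : ℕ}
    (h : ∀ j < k, x (τ (j + 1)) = x' (τ' (j + 1))) : runningMax x τ k = runningMax x' τ' k := by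
  induction k with
  | zero => rfl
  | succ k ih =>
    rw [runningMax, runningMax, ih fun j hj => h j (hj.trans k.lt_succ_self), h k k.lt_succ_self]

/-- The path with jumps `d 0, d 1, …` at the times `1, 2, …`. -/
def partialSumPath (d : ℕ → ℝ) (s : ℝ≥0) : ℝ := ∑ i ∈ Finset.range ⌊s⌋₊, d i

variable {X : ℝ≥0 → Ω → ℝ}

/-- The state after the `k`-th opportunity is independent of the later increments. -/
lemma indepFun_state_increment (hX : IsLevyProcess X P) {τ : ℕ → ℝ≥0} (hτ : Monotone τ)
    (hτ0 : τ 0 = 0) (k : ℕ) {t : ℝ≥0} (ht : τ k ≤ t) :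
    IndepFun (fun ω => X (τ k) ω + runningMax (fun s => X s ω) τ k)
      (fun ω => X t ω - X (τ k) ω) P := by
  -- Along `u` the first `k` increments determine the state at `τ k`, and the increment with index
  -- `k` is `X t - X (τ k)`.
  set u : ℕ → ℝ≥0 := fun j => if j ≤ k then τ j else t with hu
  have humono : Monotone u := by
    intro i j hij
    simp only [hu]
    split_ifs with h1 h2 h2
    · exact hτ hij
    · exact (hτ h1).trans ht
    · omega
    · exact le_rfl
  have hind := hX.indep_increments.nat humono
  set D : ℕ → Ω → ℝ := fun i ω => X (u (i + 1)) ω - X (u i) ω with hD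
  have hDm : ∀ i, Measurable (D i) := fun i => (hX.measurable _).sub (hX.measurable _)
  have h1 := hind.indepFun_finset (Finset.range k) {k} (by simp) hDm
  let ext : (Finset.range k → ℝ) → ℕ → ℝ := fun d i => if h : i ∈ Finset.range k then d ⟨i, h⟩ else 0
  have hext : Measurable ext := by
    refine measurable_pi_lambda _ fun i => ?_
    by_cases h : i ∈ Finset.range k
    · simp only [ext, h, dite_true]; exact measurable_pi_apply _
    · simp only [ext, h, dite_false]; exact measurable_const
  have hpath : ∀ s, Measurable fun d : Finset.range k → ℝ => partialSumPath (ext d) s := by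
    intro s
    unfold partialSumPath
    exact Finset.measurable_sum _ fun i _ => (measurable_pi_apply i).comp hext
  -- The state as a measurable function of the increments: the path is rebuilt from its partial
  -- sums, with the opportunities moved to integer times.
  let φ : (Finset.range k → ℝ) → ℝ := fun d =>
    partialSumPath (ext d) k + runningMax (partialSumPath (ext d)) (fun j => (j : ℝ≥0)) k
  have hφ : Measurable φ := (hpath _).add (measurable_runningMax (fun j => hpath _) k)
  let ψ : (({k} : Finset ℕ) → ℝ) → ℝ := fun d => d ⟨k, Finset.mem_singleton_self k⟩
  have hψ : Measurable ψ := measurable_pi_apply _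
  refine (h1.comp hφ hψ).congr ?_ ?_
  · filter_upwards [hX.zero] with ω h0
    have hS : ∀ j ≤ k, partialSumPath (ext fun i : Finset.range k => D i ω) (j : ℝ≥0) =
        X (τ j) ω := by
      intro j hj
      have h2 : ∀ i ∈ Finset.range j, ext (fun i : Finset.range k => D i ω) i =
          X (τ (i + 1)) ω - X (τ i) ω := by
        intro i hi
        have hi' : i < k := (Finset.mem_range.1 hi).trans_le hj
        simp [ext, hi', D, u, hi'.le]
      rw [partialSumPath, Nat.floor_natCast, Finset.sum_congr rfl h2,
        Finset.sum_range_sub (fun i => X (τ i) ω), hτ0, h0, sub_zero]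
    simp only [Function.comp, φ]
    rw [hS k le_rfl, runningMax_congr (x' := fun s => X s ω) (τ' := τ) fun j hj => ?_]
    exact_mod_cast hS (j + 1) hj
  · exact Eventually.of_forall fun ω => by simp [ψ, D, u]

variable {γ σ : ℝ} {ν : Measure ℝ}

/-- For deterministic control opportunities, the path controlled at the first `k` of them spends no
time at a given point after the `k`-th. -/
lemma ae_ae_state_ne [IsProbabilityMeasure P] (hX : IsLevyProcess X P)
    (hν : HasLevyTriplet X P γ σ ν) (hcpp : ¬ IsDriftlessCompoundPoisson X P) {τ : ℕ → ℝ≥0}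
    (hτ : Monotone τ) (hτ0 : τ 0 = 0) (k : ℕ) (y : ℝ) :
    ∀ᵐ t : ℝ, (τ k : ℝ) ≤ t →
      ∀ᵐ ω ∂P, X t.toNNReal ω + runningMax (fun s => X s ω) τ k ≠ y := by
  set A : Ω → ℝ := fun ω => X (τ k) ω + runningMax (fun s => X s ω) τ k with hA
  have hAm : Measurable A := (hX.measurable _).add
    (measurable_runningMax (τ := fun _ => τ) (fun j => hX.measurable _) k)
  have hE := hX.measurable_evalRight_path
  have h1 : ∀ z, ∀ᵐ s : ℝ ∂(volume.restrict (Ioi 0)), ∀ᵐ ω ∂P,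
      evalRight (fun r => X r ω) s.toNNReal ≠ z := by
    intro z
    have hms : MeasurableSet {p : Ω × ℝ | evalRight (fun s => X s p.1) p.2.toNNReal ≠ z} :=
      (measurableSet_eq_fun hE measurable_const).compl
    refine (Measure.ae_ae_comm hms).1 ((Measure.ae_prod_iff_ae_ae hms).1 ?_)
    rw [ae_iff]
    simpa using measure_evalRight_eq_zero hX hν hcpp z
  have hms2 : MeasurableSet {p : Ω × ℝ |
      ∀ᵐ ω ∂P, evalRight (fun r => X r ω) p.2.toNNReal ≠ y - A p.1} := by
    have hms3 : MeasurableSet {r : (Ω × ℝ) × Ω |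
        evalRight (fun s => X s r.2) r.1.2.toNNReal = y - A r.1.1} := by
      refine measurableSet_eq_fun ?_ ?_
      · exact hE.comp (measurable_snd.prodMk (measurable_snd.comp measurable_fst))
      · exact measurable_const.sub (hAm.comp (measurable_fst.comp measurable_fst))
    have := measurable_measure_prodMk_left (ν := P) hms3
    refine (this (measurableSet_singleton 0)).congr ?_
    ext p
    simp [ae_iff]
  -- The null set of times in `h1` depends on the point `z`. Taking `z = y - A ω'` and exchanging
  -- the order yields a single null set of times for almost all `ω'`.
  have h2 : ∀ᵐ s : ℝ ∂(volume.restrict (Ioi 0)), ∀ᵐ ω' ∂P, ∀ᵐ ω ∂P,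
      evalRight (fun r => X r ω) s.toNNReal ≠ y - A ω' :=
    (Measure.ae_ae_comm hms2).1 (Eventually.of_forall fun ω' => h1 (y - A ω'))
  rw [ae_restrict_iff' measurableSet_Ioi] at h2
  have h3 := (measurePreserving_sub_right volume (τ k : ℝ)).quasiMeasurePreserving.ae h2
  filter_upwards [h3, (countable_singleton (τ k : ℝ)).ae_notMem volume] with t ht hne hle
  have hlt : (τ k : ℝ) < t := lt_of_le_of_ne hle fun h => hne (by simp [h])
  have ht0 : 0 ≤ t := (τ k).coe_nonneg.trans hle
  have hkt : τ k ≤ t.toNNReal := by rwa [← NNReal.coe_le_coe, Real.coe_toNNReal _ ht0]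
  have hind := indepFun_state_increment hX hτ hτ0 k hkt
  have hst := hX.stationary (τ k) (t.toNNReal - τ k)
  have hs : (t - (τ k : ℝ)).toNNReal = t.toNNReal - τ k := by
    refine NNReal.coe_injective ?_
    rw [NNReal.coe_sub hkt, Real.coe_toNNReal _ (sub_nonneg.2 hle), Real.coe_toNNReal _ ht0]
  have hadd : τ k + (t.toNNReal - τ k) = t.toNNReal := add_tsub_cancel_of_le hkt
  rw [hadd, ← hs] at hst
  specialize ht (sub_pos.2 hlt)
  have hBm : Measurable fun ω => X t.toNNReal ω - X (τ k) ω :=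
    (hX.measurable _).sub (hX.measurable _)
  have hΦ : Measurable (indicator {p : ℝ × ℝ | p.2 + p.1 = y} (fun _ => (1 : ℝ≥0∞))) :=
    measurable_const.indicator (measurableSet_eq_fun (by fun_prop) measurable_const)
  -- The probability that state plus increment equals `y` is computed with the state frozen; the
  -- increment has the law of `X` at time `t - τ k`.
  have hkey := lintegral_indepFun hBm hAm hind.symm hΦ
  have hzero : ∫⁻ ω', ∫⁻ ω, indicator {p : ℝ × ℝ | p.2 + p.1 = y} (fun _ => (1 : ℝ≥0∞))
      (X t.toNNReal ω - X (τ k) ω, A ω') ∂P ∂P = 0 := by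
    rw [lintegral_eq_zero_iff' (Measurable.lintegral_prod_right' (f := fun p : Ω × Ω =>
      indicator {p : ℝ × ℝ | p.2 + p.1 = y} (fun _ => (1 : ℝ≥0∞))
      (X t.toNNReal p.2 - X (τ k) p.2, A p.1))
      (hΦ.comp ((hBm.comp measurable_snd).prodMk (hAm.comp measurable_fst)))).aemeasurable]
    filter_upwards [ht] with ω' hω'
    have hω'' : ∀ᵐ ω ∂P, X (t - (τ k : ℝ)).toNNReal ω ≠ y - A ω' := by
      filter_upwards [hω', hX.ae_evalRight_eq] with ω h4 h5
      rwa [h5] at h4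
    have h6 := hst.symm.ae_mem_snd (t := {y - A ω'}ᶜ) (measurableSet_singleton _).compl hω''
    refine (lintegral_eq_zero_iff (hΦ.comp (hBm.prodMk measurable_const))).2 ?_
    filter_upwards [h6] with ω h7
    rw [Pi.zero_apply]
    refine indicator_of_notMem (fun h8 => h7 ?_) _
    have h9 : A ω' + (X t.toNNReal ω - X (τ k) ω) = y := h8
    simp only [mem_singleton_iff]
    linarith
  rw [hzero] at hkey
  filter_upwards [(lintegral_eq_zero_iff (hΦ.comp (hBm.prodMk hAm))).1 hkey] with ω hω heq
  have h10 : (X t.toNNReal ω - X (τ k) ω, A ω) ∈ {p : ℝ × ℝ | p.2 + p.1 = y} := by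
    show A ω + (X t.toNNReal ω - X (τ k) ω) = y
    rw [← heq, hA]
    ring
  simp only [Function.comp, indicator_of_mem h10, Pi.zero_apply, one_ne_zero] at hω

end Indep

/-! ### A jointly measurable version of the controlled path -/

/-- The total control up to time `t`, for paths evaluated through `evalRight`. -/
def controlAmount (x : ℝ≥0 → ℝ) (τ : ℕ → ℝ≥0) (t : ℝ≥0) : ℝ≥0∞ :=
  ∑' k, if τ k ≤ t ∧ t < τ (k + 1) then ENNReal.ofReal (runningMax (evalRight x) τ k) else 0

lemma controlAmount_eq (x : ℝ≥0 → ℝ) {τ : ℕ → ℝ≥0} (hτ : StrictMono τ) {k : ℕ} {t : ℝ≥0}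
    (h1 : τ k ≤ t) (h2 : t < τ (k + 1)) :
    controlAmount x τ t = ENNReal.ofReal (runningMax (evalRight x) τ k) := by
  rw [controlAmount, tsum_eq_single k, if_pos ⟨h1, h2⟩]
  intro j hj
  refine if_neg fun ⟨h3, h4⟩ => hj ?_
  have h5 : j < k + 1 := hτ.lt_iff_lt.1 (h3.trans_lt h2)
  have h6 : k < j + 1 := hτ.lt_iff_lt.1 (h1.trans_lt h4)
  omega

lemma measurable_runningMax_evalRight (k : ℕ) :
    Measurable fun p : (ℝ≥0 → ℝ) × (ℕ → ℝ≥0) => runningMax (evalRight p.1) p.2 k := by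
  refine measurable_runningMax (fun j => ?_) k
  have h : Measurable fun p : (ℝ≥0 → ℝ) × (ℕ → ℝ≥0) => (p.1, p.2 (j + 1)) :=
    measurable_fst.prodMk ((measurable_pi_apply (j + 1)).comp measurable_snd)
  exact measurable_evalRight.comp h

/-- Values in `ℝ≥0∞` make the countable sum measurable without any condition on the times. -/
lemma measurable_controlAmount :
    Measurable fun p : ((ℝ≥0 → ℝ) × (ℕ → ℝ≥0)) × ℝ≥0 => controlAmount p.1.1 p.1.2 p.2 := by
  refine Measurable.tsum fun k => ?_
  have h : ∀ j, Measurable fun p : ((ℝ≥0 → ℝ) × (ℕ → ℝ≥0)) × ℝ≥0 => p.1.2 j := fun j =>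
    (measurable_pi_apply j).comp (measurable_snd.comp measurable_fst)
  have hset : MeasurableSet {p : ((ℝ≥0 → ℝ) × (ℕ → ℝ≥0)) × ℝ≥0 |
      p.1.2 k ≤ p.2 ∧ p.2 < p.1.2 (k + 1)} := by
    have h1 := measurableSet_le (h k) measurable_snd
    have h2 := measurableSet_lt measurable_snd (h (k + 1))
    exact h1.inter h2
  refine Measurable.ite hset ?_ measurable_const
  exact ((measurable_runningMax_evalRight k).comp measurable_fst).ennreal_ofReal

section ControlledValue

variable {Ω : Type*} [MeasurableSpace Ω] {P : Measure Ω} {X : ℝ≥0 → Ω → ℝ} {T : ℕ → Ω → ℝ≥0}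
  {γ σ : ℝ} {ν : Measure ℝ} {η q : ℝ}

/-- A jointly measurable version of the controlled path with barrier and starting point `0`. -/
def controlledValue (X : ℝ≥0 → Ω → ℝ) (T : ℕ → Ω → ℝ≥0) (p : Ω × ℝ) : ℝ :=
  evalRight (fun s => X s p.1) p.2.toNNReal +
    (controlAmount (fun s => X s p.1) (fun k => T k p.1) p.2.toNNReal).toReal

lemma measurable_path_arrivals (hX : IsLevyProcess X P) (hT : IsPoissonArrivals T η P) :
    Measurable fun ω => ((fun t => X t ω : ℝ≥0 → ℝ), (fun k => T k ω : ℕ → ℝ≥0)) :=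
  hX.measurable_path.prodMk (measurable_pi_lambda _ hT.measurable)

lemma measurable_controlledValue (hX : IsLevyProcess X P) (hT : IsPoissonArrivals T η P) :
    Measurable (controlledValue X T) := by
  have h : Measurable fun p : Ω × ℝ =>
      (((fun t => X t p.1 : ℝ≥0 → ℝ), (fun k => T k p.1 : ℕ → ℝ≥0)), p.2.toNNReal) :=
    ((measurable_path_arrivals hX hT).comp measurable_fst).prodMk
      (measurable_real_toNNReal.comp measurable_snd)
  exact hX.measurable_evalRight_path.add (measurable_controlAmount.comp h).ennreal_toReal

/-- Almost surely, the controlled path at any time is determined by the running maximum over the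
opportunities up to that time. -/
lemma ae_controlledValue (hX : IsLevyProcess X P) (hT : IsPoissonArrivals T η P) (hη : 0 < η) :
    ∀ᵐ ω ∂P, ∀ t : ℝ, ∃ k, T k ω ≤ t.toNNReal ∧
      controlledValue X T (ω, t) =
        evalRight (fun s => X s ω) t.toNNReal +
          runningMax (evalRight fun s => X s ω) (fun k => T k ω) k ∧
      ∀ b, controlledPath b (fun s => b + X s ω) (fun k => T k ω) t.toNNReal =
        b + controlledValue X T (ω, t) := by
  filter_upwards [hX.ae_evalRight_eq, hT.ae_strictMono hη, hT.ae_exists_lt hη] with ω h1 h2 h3 t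
  obtain ⟨k, hk1, hk2⟩ := exists_mem_Ico_of_exists_lt (τ := fun k => T k ω) (hT.zero ω)
    (h3 t.toNNReal)
  have hval : controlledValue X T (ω, t) =
      evalRight (fun s => X s ω) t.toNNReal +
        runningMax (evalRight fun s => X s ω) (fun k => T k ω) k := by
    rw [controlledValue, controlAmount_eq _ h2 hk1 hk2,
      ENNReal.toReal_ofReal (runningMax_nonneg _ _ _)]
  refine ⟨k, hk1, hval, fun b => ?_⟩
  have h4 : (evalRight fun s => X s ω) = fun s => X s ω := funext h1
  rw [controlledPath_eq b (fun s => X s ω) h2 (hT.zero ω) hk1 hk2, hval, h4]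

/-- The controlled path spends no time at a given point. -/
lemma ae_controlledValue_ne [IsProbabilityMeasure P] (hX : IsLevyProcess X P)
    (hν : HasLevyTriplet X P γ σ ν) (hT : IsPoissonArrivals T η P) (hη : 0 < η)
    (hXT : IndepFun (fun ω t => X t ω) (fun ω k => T k ω) P)
    (hcpp : ¬ IsDriftlessCompoundPoisson X P) (y : ℝ) :
    ∀ᵐ p ∂(P.prod (volume.restrict (Ioi 0))), controlledValue X T p ≠ y := by
  have hk : ∀ k, ∀ᵐ ω ∂P, ∀ᵐ t ∂(volume.restrict (Ioi (0 : ℝ))),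
      ¬ (T k ω ≤ t.toNNReal ∧ evalRight (fun s => X s ω) t.toNNReal +
        runningMax (evalRight fun s => X s ω) (fun k => T k ω) k = y) := by
    intro k
    have hS : MeasurableSet {r : ((ℝ≥0 → ℝ) × (ℕ → ℝ≥0)) × ℝ | r.1.2 k ≤ r.2.toNNReal ∧
        evalRight r.1.1 r.2.toNNReal + runningMax (evalRight r.1.1) r.1.2 k = y} := by
      have hm1 : Measurable fun r : ((ℝ≥0 → ℝ) × (ℕ → ℝ≥0)) × ℝ => r.1.2 k :=
        (measurable_pi_apply k).comp (measurable_snd.comp measurable_fst)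
      have hm2 : Measurable fun r : ((ℝ≥0 → ℝ) × (ℕ → ℝ≥0)) × ℝ => r.2.toNNReal :=
        measurable_real_toNNReal.comp measurable_snd
      have hm3 : Measurable fun r : ((ℝ≥0 → ℝ) × (ℕ → ℝ≥0)) × ℝ => (r.1.1, r.2.toNNReal) :=
        (measurable_fst.comp measurable_fst).prodMk hm2
      exact (measurableSet_le hm1 hm2).inter (measurableSet_eq_fun
        ((measurable_evalRight.comp hm3).add
          ((measurable_runningMax_evalRight k).comp measurable_fst)) measurable_const)
    have hΦ := measurable_measure_prodMk_left (ν := volume.restrict (Ioi (0 : ℝ))) hS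
    have hXm := hX.measurable_path
    have hTm : Measurable fun ω => fun k => T k ω := measurable_pi_lambda _ hT.measurable
    -- Independence allows the arrival times to be frozen at a sample `ω'`, which reduces the claim
    -- to deterministic opportunities.
    have hkey := lintegral_indepFun hXm hTm hXT hΦ
    have hzero : ∀ᵐ ω' ∂P, ∫⁻ ω, (volume.restrict (Ioi (0 : ℝ))) (Prod.mk
        ((fun t => X t ω : ℝ≥0 → ℝ), (fun k => T k ω' : ℕ → ℝ≥0)) ⁻¹'
        {r : ((ℝ≥0 → ℝ) × (ℕ → ℝ≥0)) × ℝ | r.1.2 k ≤ r.2.toNNReal ∧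
        evalRight r.1.1 r.2.toNNReal + runningMax (evalRight r.1.1) r.1.2 k = y}) ∂P = 0 := by
      filter_upwards [hT.ae_strictMono hη] with ω' hω'
      have h1 := ae_ae_state_ne hX hν hcpp (τ := fun k => T k ω') hω'.monotone (hT.zero ω') k y
      have hm4 : Measurable fun ω => ((fun t => X t ω : ℝ≥0 → ℝ), (fun k => T k ω' : ℕ → ℝ≥0)) :=
        hXm.prodMk measurable_const
      have hm5 : Measurable fun p : Ω × ℝ =>
          (((fun t => X t p.1 : ℝ≥0 → ℝ), (fun k => T k ω' : ℕ → ℝ≥0)), p.2) :=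
        (hm4.comp measurable_fst).prodMk measurable_snd
      refine (lintegral_eq_zero_iff (hΦ.comp hm4)).2 ?_
      have h2 : ∀ᵐ ω ∂P, ∀ᵐ t ∂(volume.restrict (Ioi (0 : ℝ))),
          ¬ (T k ω' ≤ t.toNNReal ∧ evalRight (fun s => X s ω) t.toNNReal +
            runningMax (evalRight fun s => X s ω) (fun k => T k ω') k = y) := by
        rw [Measure.ae_ae_comm (hm5 hS).compl]
        filter_upwards [ae_restrict_of_ae h1, ae_restrict_mem measurableSet_Ioi] with t ht ht0
        by_cases hkt : (T k ω' : ℝ) ≤ t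
        · filter_upwards [ht hkt, hX.ae_evalRight_eq] with ω h3 h4 h5
          have h6 : (evalRight fun s => X s ω) = fun s => X s ω := funext h4
          rw [h6] at h5
          exact h3 h5.2
        · refine Eventually.of_forall fun ω h3 => hkt ?_
          have h4 := NNReal.coe_le_coe.2 h3.1
          rwa [Real.coe_toNNReal _ (le_of_lt ht0)] at h4
      filter_upwards [h2] with ω h3
      rw [ae_iff] at h3
      simpa using h3
    rw [lintegral_congr_ae hzero, lintegral_zero] at hkey
    filter_upwards [(lintegral_eq_zero_iff (hΦ.comp (measurable_path_arrivals hX hT))).1 hkey]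
      with ω hω
    rw [ae_iff]
    simpa using hω
  have hms : MeasurableSet {p | controlledValue X T p ≠ y} :=
    (measurableSet_eq_fun (measurable_controlledValue hX hT) measurable_const).compl
  refine (Measure.ae_prod_iff_ae_ae hms).2 ?_
  filter_upwards [ae_all_iff.2 hk, ae_controlledValue hX hT hη] with ω h1 h2
  filter_upwards [ae_all_iff.2 h1] with t h3 heq
  obtain ⟨k, hk1, hk2, -⟩ := h2 t
  exact h3 k ⟨hk1, hk2 ▸ heq⟩

/-! ### Integrability -/

lemma discountMeasure_le (hq : 0 < q) (s : ℝ≥0) :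
    discountMeasure q {t : ℝ | s ≤ t.toNNReal} ≤ ENNReal.ofReal (Real.exp (-(q * s)) / q) := by
  have hms : MeasurableSet {t : ℝ | s ≤ t.toNNReal} :=
    measurableSet_le measurable_const measurable_real_toNNReal
  rw [discountMeasure, withDensity_apply _ hms, Measure.restrict_restrict hms,
    ← lintegral_discount hq, setLIntegral_congr (Ioi_ae_eq_Ici (a := (s : ℝ)))]
  refine lintegral_mono_set fun t ht => ?_
  have h1 := NNReal.coe_le_coe.2 (show s ≤ t.toNNReal from ht.1)
  rwa [Real.coe_toNNReal _ (le_of_lt (show 0 < t from ht.2))] at h1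

/-- Moment growth at rate `q/2` against the discount `e^{-qt}` leaves the integrable `e^{-qt/2}`. -/
lemma lintegral_evalRight_pow_lt_top [IsProbabilityMeasure P] (hX : IsLevyProcess X P)
    (hq : 0 < q) {N : ℕ} {K : ℝ} (hK : 0 ≤ K)
    (hmom : ∀ t : ℝ≥0,
      ∫⁻ ω, ENNReal.ofReal (|X t ω| ^ N) ∂P ≤ ENNReal.ofReal (K * Real.exp (q / 2 * t))) :
    ∫⁻ p, ENNReal.ofReal (|evalRight (fun s => X s p.1) p.2.toNNReal| ^ N)
      ∂(P.prod (discountMeasure q)) < ∞ := by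
  have := isFiniteMeasure_discountMeasure hq
  have hE := hX.measurable_evalRight_path
  have hm : Measurable fun p : Ω × ℝ =>
      ENNReal.ofReal (|evalRight (fun s => X s p.1) p.2.toNNReal| ^ N) := by fun_prop
  rw [lintegral_prod_symm' _ hm, discountMeasure, lintegral_withDensity_eq_lintegral_mul _
    (measurable_discount q) hm.lintegral_prod_left']
  calc ∫⁻ t in Ioi (0 : ℝ), ((fun t => ENNReal.ofReal (Real.exp (-(q * t)))) * fun t : ℝ =>
          ∫⁻ ω, ENNReal.ofReal (|evalRight (fun s => X s ω) t.toNNReal| ^ N) ∂P) t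
      ≤ ∫⁻ t in Ioi (0 : ℝ), ENNReal.ofReal K * ENNReal.ofReal (Real.exp (-(q / 2 * t))) := by
        refine setLIntegral_mono' measurableSet_Ioi fun t ht => ?_
        have h1 : ∫⁻ ω, ENNReal.ofReal (|evalRight (fun s => X s ω) t.toNNReal| ^ N) ∂P ≤
            ENNReal.ofReal (K * Real.exp (q / 2 * t)) := by
          refine le_trans (le_of_eq (lintegral_congr_ae ?_)) ((hmom t.toNNReal).trans_eq ?_)
          · filter_upwards [hX.ae_evalRight_eq] with ω hω
            rw [hω]
          · rw [Real.coe_toNNReal _ (le_of_lt ht)]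
        rw [Pi.mul_apply]
        calc _ ≤ ENNReal.ofReal (Real.exp (-(q * t))) *
              ENNReal.ofReal (K * Real.exp (q / 2 * t)) := by gcongr
          _ = _ := by
            rw [← ENNReal.ofReal_mul (Real.exp_pos _).le, ← ENNReal.ofReal_mul hK,
              mul_left_comm, ← Real.exp_add]
            ring_nf
    _ < ∞ := by
        rw [lintegral_const_mul _ (measurable_discount _), lintegral_discount (by positivity)]
        exact ENNReal.mul_lt_top ENNReal.ofReal_lt_top ENNReal.ofReal_lt_top

/-- With the arrival time frozen at `s`, growth `K e^{qs/2}` meets the discounted mass `e^{-qs}/q`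
of the times after `s`. -/
lemma lintegral_evalRight_arrival_le [IsProbabilityMeasure P] (hX : IsLevyProcess X P)
    (hT : IsPoissonArrivals T η P) (hXT : IndepFun (fun ω t => X t ω) (fun ω k => T k ω) P)
    {N : ℕ} {K : ℝ} (hK : 0 ≤ K)
    (hmom : ∀ t : ℝ≥0,
      ∫⁻ ω, ENNReal.ofReal (|X t ω| ^ N) ∂P ≤ ENNReal.ofReal (K * Real.exp (q / 2 * t))) (j : ℕ) :
    ∫⁻ ω, ENNReal.ofReal (|evalRight (fun s => X s ω) (T j ω)| ^ N) *
        ENNReal.ofReal (Real.exp (-(q * T j ω)) / q) ∂P ≤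
      ENNReal.ofReal (K / q) * ∫⁻ ω, ENNReal.ofReal (Real.exp (-(q / 2 * T j ω))) ∂P := by
  have hTm := hT.measurable j
  have hΦ : Measurable fun p : (ℝ≥0 → ℝ) × ℝ≥0 => ENNReal.ofReal (|evalRight p.1 p.2| ^ N) *
      ENNReal.ofReal (Real.exp (-(q * p.2)) / q) := by
    have := measurable_evalRight
    fun_prop
  have hind : IndepFun (fun ω t => X t ω) (T j) P :=
    hXT.comp (φ := id) (ψ := fun f : ℕ → ℝ≥0 => f j) measurable_id (measurable_pi_apply j)
  rw [lintegral_indepFun hX.measurable_path hTm hind hΦ, ← lintegral_const_mul _ (by fun_prop)]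
  refine lintegral_mono fun ω' => ?_
  simp only
  have hm : Measurable fun ω => ENNReal.ofReal (|evalRight (fun s => X s ω) (T j ω')| ^ N) := by
    have h : Measurable fun ω => ((fun s => X s ω : ℝ≥0 → ℝ), T j ω') :=
      hX.measurable_path.prodMk measurable_const
    have h2 := measurable_evalRight.comp h
    exact (h2.abs.pow_const N).ennreal_ofReal
  rw [lintegral_mul_const _ hm]
  have h1 : ∫⁻ ω, ENNReal.ofReal (|evalRight (fun s => X s ω) (T j ω')| ^ N) ∂P ≤
      ENNReal.ofReal (K * Real.exp (q / 2 * T j ω')) := by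
    refine le_trans (le_of_eq (lintegral_congr_ae ?_)) (hmom _)
    filter_upwards [hX.ae_evalRight_eq] with ω hω
    rw [hω]
  calc _ ≤ ENNReal.ofReal (K * Real.exp (q / 2 * T j ω')) *
        ENNReal.ofReal (Real.exp (-(q * T j ω')) / q) := by gcongr
    _ = ENNReal.ofReal (K / q) * ENNReal.ofReal (Real.exp (-(q / 2 * T j ω'))) := by
        rw [← ENNReal.ofReal_mul (by positivity), ← ENNReal.ofReal_mul' (Real.exp_pos _).le]
        congr 1
        rw [show -(q / 2 * (T j ω' : ℝ)) = q / 2 * T j ω' + -(q * T j ω') by ring, Real.exp_add]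
        ring

/-- `|V|^N` is at most `2^(N-1)` times the sum of `|X_t|^N` and the `N`-th power of the running
maximum. The latter is bounded by the sum of `|X|^N` over the arrivals up to `t`; the expected
discounted contributions of the arrivals form a convergent geometric series. -/
lemma integrable_abs_controlledValue_pow [IsProbabilityMeasure P] (hX : IsLevyProcess X P)
    (hν : HasLevyTriplet X P γ σ ν) (hT : IsPoissonArrivals T η P) (hη : 0 < η)
    (hXT : IndepFun (fun ω t => X t ω) (fun ω k => T k ω) P) {θ : ℝ} (hθ : 0 < θ)
    (hexp : ∫⁻ z in {z : ℝ | 1 ≤ |z|}, ENNReal.ofReal (Real.exp (θ * |z|)) ∂ν < ∞)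
    (hq : 0 < q) {N : ℕ} (hN : N ≠ 0) :
    Integrable (fun p => |controlledValue X T p| ^ N) (P.prod (discountMeasure q)) := by
  have := isFiniteMeasure_discountMeasure hq
  obtain ⟨K, hK, hmom⟩ := exists_lintegral_pow_le hX.measurable hν hθ hexp
    (a := q / 2) (by positivity) N
  have hVm := measurable_controlledValue hX hT
  refine ⟨(by fun_prop : Measurable _).aestronglyMeasurable,
    (hasFiniteIntegral_iff_ofReal (Eventually.of_forall fun p => by positivity)).2 ?_⟩
  set W : Ω × ℝ → ℝ≥0∞ := fun p => ∑' j, if T (j + 1) p.1 ≤ p.2.toNNReal then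
    ENNReal.ofReal (|evalRight (fun s => X s p.1) (T (j + 1) p.1)| ^ N) else 0 with hW
  have hEj : ∀ j, Measurable fun ω =>
      ENNReal.ofReal (|evalRight (fun s => X s ω) (T (j + 1) ω)| ^ N) := by
    intro j
    have h : Measurable fun ω => ((fun s => X s ω : ℝ≥0 → ℝ), T (j + 1) ω) :=
      hX.measurable_path.prodMk (hT.measurable _)
    have h2 := measurable_evalRight.comp h
    exact (h2.abs.pow_const N).ennreal_ofReal
  have hWj : ∀ j, Measurable fun p : Ω × ℝ => if T (j + 1) p.1 ≤ p.2.toNNReal then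
      ENNReal.ofReal (|evalRight (fun s => X s p.1) (T (j + 1) p.1)| ^ N) else 0 := fun j =>
    Measurable.ite (measurableSet_le ((hT.measurable _).comp measurable_fst)
      (measurable_real_toNNReal.comp measurable_snd)) ((hEj j).comp measurable_fst)
      measurable_const
  have hWfin : ∫⁻ p, W p ∂(P.prod (discountMeasure q)) < ∞ := by
    rw [hW, lintegral_tsum fun j => (hWj j).aemeasurable]
    have hle : ∀ j, ∫⁻ p : Ω × ℝ, (if T (j + 1) p.1 ≤ p.2.toNNReal then
        ENNReal.ofReal (|evalRight (fun s => X s p.1) (T (j + 1) p.1)| ^ N) else 0)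
        ∂(P.prod (discountMeasure q)) ≤
        ENNReal.ofReal (K / q) * ∫⁻ ω, ENNReal.ofReal (Real.exp (-(q / 2 * T (j + 1) ω))) ∂P := by
      intro j
      rw [lintegral_prod _ (hWj j).aemeasurable]
      refine le_trans (lintegral_mono fun ω => ?_)
        (lintegral_evalRight_arrival_le hX hT hXT hK hmom (j + 1))
      have hms : MeasurableSet {t : ℝ | T (j + 1) ω ≤ t.toNNReal} :=
        measurableSet_le measurable_const measurable_real_toNNReal
      calc _ = ∫⁻ t, indicator {t : ℝ | T (j + 1) ω ≤ t.toNNReal} (fun _ =>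
            ENNReal.ofReal (|evalRight (fun s => X s ω) (T (j + 1) ω)| ^ N)) t
            ∂(discountMeasure q) := by
            refine lintegral_congr fun t => ?_
            simp [indicator_apply]
        _ ≤ _ := by
            rw [lintegral_indicator_const hms]
            gcongr
            exact discountMeasure_le hq _
    refine lt_of_le_of_lt (ENNReal.tsum_le_tsum hle) ?_
    rw [ENNReal.tsum_mul_left]
    refine ENNReal.mul_lt_top ENNReal.ofReal_lt_top (lt_of_le_of_lt ?_
      (hT.tsum_lintegral_exp_lt_top hη (a := q / 2) (by positivity)))
    -- Only the arrivals with index at least `1` enter `W`, so the sum is part of the full series.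
    exact ENNReal.tsum_comp_le_tsum_of_injective (add_left_injective 1) _
  have hE := hX.measurable_evalRight_path
  have hEm : Measurable fun p : Ω × ℝ =>
      ENNReal.ofReal (|evalRight (fun s => X s p.1) p.2.toNNReal| ^ N) := by fun_prop
  have hbound : ∀ᵐ p ∂(P.prod (discountMeasure q)),
      ENNReal.ofReal (|controlledValue X T p| ^ N) ≤ 2 ^ (N - 1) *
        (ENNReal.ofReal (|evalRight (fun s => X s p.1) p.2.toNNReal| ^ N) + W p) := by
    have hgood : ∀ᵐ p ∂(P.prod (discountMeasure q)), StrictMono (fun k => T k p.1) ∧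
        ∃ k, T k p.1 ≤ p.2.toNNReal ∧ controlledValue X T p =
        evalRight (fun s => X s p.1) p.2.toNNReal +
          runningMax (evalRight fun s => X s p.1) (fun k => T k p.1) k := by
      have h := (hT.ae_strictMono hη).and (ae_controlledValue hX hT hη)
      filter_upwards [Measure.quasiMeasurePreserving_fst.ae h] with p hp
      obtain ⟨k, h1, h2, -⟩ := hp.2 p.2
      exact ⟨hp.1, k, h1, h2⟩
    filter_upwards [hgood] with p ⟨hmono, k, h1, h2⟩
    set M := runningMax (evalRight fun s => X s p.1) (fun k => T k p.1) k with hM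
    have hM0 : 0 ≤ M := runningMax_nonneg _ _ _
    have hMW : ENNReal.ofReal (M ^ N) ≤ W p := by
      calc ENNReal.ofReal (M ^ N) ≤ ENNReal.ofReal (∑ j ∈ Finset.range k,
            |evalRight (fun s => X s p.1) (T (j + 1) p.1)| ^ N) :=
            ENNReal.ofReal_le_ofReal (runningMax_pow_le _ _ hN k)
        _ = ∑ j ∈ Finset.range k, (if T (j + 1) p.1 ≤ p.2.toNNReal then
            ENNReal.ofReal (|evalRight (fun s => X s p.1) (T (j + 1) p.1)| ^ N) else 0) := by
            rw [ENNReal.ofReal_sum_of_nonneg fun j _ => by positivity]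
            refine Finset.sum_congr rfl fun j hj => ?_
            rw [if_pos]
            exact (hmono.monotone (Finset.mem_range.1 hj)).trans h1
        _ ≤ W p := ENNReal.sum_le_tsum _
    have h3 : |controlledValue X T p| ^ N ≤
        2 ^ (N - 1) * (|evalRight (fun s => X s p.1) p.2.toNNReal| ^ N + M ^ N) := by
      refine le_trans ?_ (add_pow_le (abs_nonneg _) hM0 N)
      rw [h2]
      gcongr
      exact (abs_add_le _ _).trans_eq (by rw [abs_of_nonneg hM0])
    calc _ ≤ ENNReal.ofReal
          (2 ^ (N - 1) * (|evalRight (fun s => X s p.1) p.2.toNNReal| ^ N + M ^ N)) :=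
          ENNReal.ofReal_le_ofReal h3
      _ = 2 ^ (N - 1) * (ENNReal.ofReal (|evalRight (fun s => X s p.1) p.2.toNNReal| ^ N) +
          ENNReal.ofReal (M ^ N)) := by
          rw [ENNReal.ofReal_mul (by positivity), ENNReal.ofReal_add (by positivity)
            (by positivity), ENNReal.ofReal_pow (by norm_num), ENNReal.ofReal_ofNat]
      _ ≤ _ := by gcongr
  refine lt_of_le_of_lt (lintegral_mono_ae hbound) ?_
  rw [lintegral_const_mul' _ _ (by finiteness), lintegral_add_left hEm]
  exact ENNReal.mul_lt_top (by finiteness) (ENNReal.add_lt_top.2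
    ⟨lintegral_evalRight_pow_lt_top hX hq hK hmom, hWfin⟩)

end ControlledValue

/-! ### The function `ρ` as an integral of the slope along the shifted controlled path -/

section Rho

variable {Ω : Type*} [MeasurableSpace Ω] {P : Measure Ω} {X : ℝ≥0 → Ω → ℝ} {T : ℕ → Ω → ℝ≥0}
  {γ σ : ℝ} {ν : Measure ℝ} {η q : ℝ} {f : ℝ → ℝ}

lemma integrable_rightDeriv_controlledValue [IsProbabilityMeasure P] (hX : IsLevyProcess X P)
    (hν : HasLevyTriplet X P γ σ ν) (hT : IsPoissonArrivals T η P) (hη : 0 < η)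
    (hXT : IndepFun (fun ω t => X t ω) (fun ω k => T k ω) P) {θ : ℝ} (hθ : 0 < θ)
    (hexp : ∫⁻ z in {z : ℝ | 1 ≤ |z|}, ENNReal.ofReal (Real.exp (θ * |z|)) ∂ν < ∞)
    (hq : 0 < q) (hf : ConvexOn ℝ univ f)
    (hgrowth : ∃ (k₁ k₂ : ℝ) (N : ℕ), ∀ x, |f x| ≤ k₁ + k₂ * |x| ^ N) (b : ℝ) :
    Integrable (fun p => rightDeriv f (b + controlledValue X T p))
      (P.prod (discountMeasure q)) := by
  have := isFiniteMeasure_discountMeasure hq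
  obtain ⟨K, N, hK, hN, hg⟩ := exists_abs_rightDeriv_le hf hgrowth
  have hV := integrable_abs_controlledValue_pow hX hν hT hη hXT hθ hexp hq hN
  have hVm := measurable_controlledValue hX hT
  have hgm : Measurable (rightDeriv f) := (monotone_rightDeriv hf).measurable
  have hbd : Integrable (fun p => K * (1 + 2 ^ (N - 1) * (|b| ^ N + |controlledValue X T p| ^ N)))
      (P.prod (discountMeasure q)) :=
    ((integrable_const 1).add (((integrable_const (|b| ^ N)).add hV).const_mul _)).const_mul K
  refine hbd.mono' (hgm.comp (hVm.const_add b)).aestronglyMeasurable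
    (Eventually.of_forall fun p => (hg _).trans ?_)
  gcongr
  exact (pow_le_pow_left₀ (abs_nonneg _) (abs_add_le _ _) N).trans
    (add_pow_le (abs_nonneg _) (abs_nonneg _) N)

lemma prod_discountMeasure [IsProbabilityMeasure P] :
    P.prod (discountMeasure q) = (P.prod (volume.restrict (Ioi 0))).withDensity
      fun p => ENNReal.ofReal (Real.exp (-(q * p.2))) :=
  prod_withDensity_right (measurable_discount q)

lemma ae_discountedSlope_eq (hX : IsLevyProcess X P) (hT : IsPoissonArrivals T η P)
    (hη : 0 < η) (b : ℝ) :
    ∀ᵐ p ∂(P.prod (volume.restrict (Ioi 0))), discountedSlope X T q f b b p =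
      (ENNReal.ofReal (Real.exp (-(q * p.2)))).toReal •
        rightDeriv f (b + controlledValue X T p) := by
  filter_upwards [Measure.quasiMeasurePreserving_fst.ae (ae_controlledValue hX hT hη)] with p hp
  obtain ⟨k, -, -, h⟩ := hp p.2
  rw [discountedSlope, h b, ENNReal.toReal_ofReal (Real.exp_pos _).le, smul_eq_mul]

lemma integrable_discountedSlope [IsProbabilityMeasure P] (hX : IsLevyProcess X P)
    (hT : IsPoissonArrivals T η P) (hη : 0 < η) {b : ℝ}
    (hi : Integrable (fun p => rightDeriv f (b + controlledValue X T p))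
      (P.prod (discountMeasure q))) :
    Integrable (discountedSlope X T q f b b) (P.prod (volume.restrict (Ioi 0))) := by
  rw [prod_discountMeasure, integrable_withDensity_iff_integrable_smul' (by fun_prop)
    (Eventually.of_forall fun _ => ENNReal.ofReal_lt_top)] at hi
  exact hi.congr ((ae_discountedSlope_eq hX hT hη b).mono fun p hp => hp.symm)

lemma rho_eq_integral [IsProbabilityMeasure P] (hX : IsLevyProcess X P)
    (hT : IsPoissonArrivals T η P) (hη : 0 < η) {b : ℝ}
    (hi : Integrable (fun p => rightDeriv f (b + controlledValue X T p))
      (P.prod (discountMeasure q))) :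
    rho X T P q f b =
      ∫ p, rightDeriv f (b + controlledValue X T p) ∂(P.prod (discountMeasure q)) := by
  rw [rho, ← integral_prod _ (integrable_discountedSlope hX hT hη hi), prod_discountMeasure,
    integral_withDensity_eq_integral_toReal_smul (by fun_prop)
      (Eventually.of_forall fun _ => ENNReal.ofReal_lt_top)]
  exact integral_congr_ae (ae_discountedSlope_eq hX hT hη b)

lemma measureReal_prod_discountMeasure [IsProbabilityMeasure P] (hq : 0 < q) :
    (P.prod (discountMeasure q)).real univ = 1 / q := by
  have := isFiniteMeasure_discountMeasure hq
  rw [measureReal_def, Measure.prod_apply MeasurableSet.univ]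
  simp [discountMeasure_univ hq, hq.le]

end Rho

end PeriodicBarrier

end

/-! ### The main theorem -/

theorem lemma4p1 {Ω : Type*} [MeasurableSpace Ω] (P : Measure Ω) [IsProbabilityMeasure P]
    (X : ℝ≥0 → Ω → ℝ) (T : ℕ → Ω → ℝ≥0) (γ σ : ℝ) (ν : Measure ℝ) (η q C : ℝ) (f : ℝ → ℝ)
    (hη : 0 < η) (hq : 0 < q)
    (hX : IsLevyProcess X P)
    (hν : HasLevyTriplet X P γ σ ν)
    (hT : IsPoissonArrivals T η P)
    (hXT : IndepFun (fun ω t => X t ω) (fun ω k => T k ω) P)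
    -- assumptions on the running cost and on the unit cost of control
    (hf_convex : ConvexOn ℝ univ f)
    (hf_growth : ∃ (k₁ k₂ : ℝ) (N : ℕ), ∀ x, |f x| ≤ k₁ + k₂ * |x| ^ N)
    (hf_bot : rightDerivAtBot f < ((-(C * q) : ℝ) : EReal))
    (hf_top : ((-(C * q) : ℝ) : EReal) < rightDerivAtTop f)
    -- assumptions on the Lévy process
    (hX_cpp : ¬ IsDriftlessCompoundPoisson X P)
    (hX_exp : ∃ θ : ℝ, 0 < θ ∧
      ∫⁻ z in {z : ℝ | 1 ≤ |z|}, ENNReal.ofReal (Real.exp (θ * |z|)) ∂ν < ∞) :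
    -- `ρ` takes finite values: the integrals that define it converge absolutely
    (∀ b, Integrable (discountedSlope X T q f b b) (P.prod (volume.restrict (Ioi 0)))) ∧
    Monotone (rho X T P q f) ∧
    Continuous (rho X T P q f) ∧
    Tendsto (fun b => (rho X T P q f b : EReal)) atTop (𝓝 (rightDerivAtTop f / (q : EReal))) ∧
    ((-C : ℝ) : EReal) < rightDerivAtTop f / (q : EReal) ∧
    Tendsto (fun b => (rho X T P q f b : EReal)) atBot (𝓝 (rightDerivAtBot f / (q : EReal))) ∧
    rightDerivAtBot f / (q : EReal) < ((-C : ℝ) : EReal) ∧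
    -- `b*` is well defined: it is the infimum of a nonempty set that is bounded below
    (barrierSet X T P q f C).Nonempty ∧ BddBelow (barrierSet X T P q f C) ∧
    IsGLB (barrierSet X T P q f C) (optimalBarrier X T P q f C) := by
  obtain ⟨θ, hθ, hexp⟩ := hX_exp
  have := isFiniteMeasure_discountMeasure hq
  have hi := integrable_rightDeriv_controlledValue hX hν hT hη hXT hθ hexp hq hf_convex hf_growth
  have hmono := monotone_rightDeriv hf_convex
  have hρ : rho X T P q f = fun b =>
      ∫ p, rightDeriv f (b + controlledValue X T p) ∂(P.prod (discountMeasure q)) :=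
    funext fun b => rho_eq_integral hX hT hη (hi b)
  have hmass := measureReal_prod_discountMeasure (P := P) hq
  -- The only place where the compound Poisson case has to be excluded; it is needed for continuity
  -- alone.
  have hne : ∀ y, ∀ᵐ p ∂(P.prod (discountMeasure q)), controlledValue X T p ≠ y := fun y => by
    rw [prod_discountMeasure]
    exact (withDensity_absolutelyContinuous _ _).ae_le
      (ae_controlledValue_ne hX hν hT hη hXT hX_cpp y)
  have hρmono : Monotone (rho X T P q f) := by
    rw [hρ]; exact monotone_integral_shift hmono hi
  have hρcont : Continuous (rho X T P q f) := by
    rw [hρ]; exact continuous_integral_shift hmono hi hne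
  have htop : Tendsto (fun b => (rho X T P q f b : EReal)) atTop
      (𝓝 (rightDerivAtTop f / (q : EReal))) := by
    rw [hρ]
    exact tendsto_integral_shift_atTop hq hmass hmono hi (tendsto_rightDerivAtTop hf_convex)
  have hbot : Tendsto (fun b => (rho X T P q f b : EReal)) atBot
      (𝓝 (rightDerivAtBot f / (q : EReal))) := by
    rw [hρ]
    exact tendsto_integral_shift_atBot hq hmass hmono hi (tendsto_rightDerivAtBot hf_convex)
  have hq0 : (0 : EReal) < q := by exact_mod_cast hq
  have hCtop : ((-C : ℝ) : EReal) < rightDerivAtTop f / (q : EReal) := by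
    rw [EReal.lt_div_iff hq0 (EReal.coe_ne_top _), ← EReal.coe_mul, neg_mul]
    exact hf_top
  have hCbot : rightDerivAtBot f / (q : EReal) < ((-C : ℝ) : EReal) := by
    rw [EReal.div_lt_iff hq0 (EReal.coe_ne_top _), ← EReal.coe_mul, neg_mul]
    exact hf_bot
  have hnonempty : (barrierSet X T P q f C).Nonempty := by
    obtain ⟨b, hb⟩ := ((tendsto_order.1 htop).1 _ hCtop).exists
    have hb' : -C < rho X T P q f b := EReal.coe_lt_coe_iff.1 hb
    exact ⟨b, show 0 ≤ rho X T P q f b + C by linarith⟩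
  -- A point where `ρ < -C`, supplied by the limit at `-∞`, is a lower bound by monotonicity.
  have hbdd : BddBelow (barrierSet X T P q f C) := by
    obtain ⟨b, hb⟩ := ((tendsto_order.1 hbot).2 _ hCbot).exists
    have hb' : rho X T P q f b < -C := EReal.coe_lt_coe_iff.1 hb
    refine ⟨b, fun a (ha : 0 ≤ rho X T P q f a + C) => ?_⟩
    by_contra! hab
    linarith [hρmono hab.le]
  exact ⟨fun b => integrable_discountedSlope hX hT hη (hi b), hρmono, hρcont, htop, hCtop, hbot,
    hCbot, hnonempty, hbdd, isGLB_csInf hnonempty hbdd⟩
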